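/- Let $p$ be a prime, $G=SL_2$ over $\mathbb F_p$ with diagonal torus $T$, $G_1$ and $T_1$ the first Frobenius kernels of $G$ and $T$, and $\mathrm{Dist}(G_1)\supseteq \mathrm{Dist}(T_1)$ their algebras of distributions (the linear duals of the coordinate rings, with convolution product). Let $X=\begin{pmatrix}0&1\\0&0\end{pmatrix}$ and $H=\begin{pmatrix}1&0\\0&-1\end{pmatrix}$ in $\mathrm{Lie}(G)\subseteq\mathrm{Dist}(G_1)$, and for $n\in\mathbb Z$ put $\mu_n=\sum_{i=0}^{p-1}(-1)^i\binom{H-n}{i}\in\mathrm{Dist}(T_1)$. For $m\in\mathbb Z$ let $\bar L(m)$ be the simple $\mathrm{Dist}(G_1)$-module of highest weight $m$ (that is, containing $v\neq0$ with $Xv=0$, $Hv=mv$; it depends only on $m$ modulo $p$), let $Q(m)$ be its projective cover, which exists, and let $\mathrm{St}$ be the Steinberg module, that is, the $\mathrm{Dist}(G_1)$-module induced from the one-dimensional module of weight $p-1$ of the subalgebra generated by $X$ and $H$ (with $X$ acting by $0$ and $H$ by $p-1$). Then, as left $\mathrm{Dist}(G_1)$-modules: (i) If $p=2$, then $\mathrm{Dist}(G_1)\mu_0\cong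 Q(0)$ and $\mathrm{Dist}(G_1)\mu_1\cong\mathrm{St}\oplus\mathrm{St}$. (ii) If $p$ is odd, then for every even integer $n$ with $0\le n<p$, $$\mathrm{Dist}(G_1)\mu_n\;\cong\bigoplus_{m\in\mathbb Z\cap\left(\left[0,\frac{n-2}{2}\right]\cup\left[n,\frac{p+n-1}{2}\right]\right)}Q(2m-n),$$ and for the index $m=\frac{p+n-1}{2}$ one has $Q(2m-n)\cong\mathrm{St}$. (iii) If $p$ is odd, then for every odd integer $n$ with $0\le n<p$, $$\mathrm{Dist}(G_1)\mu_n\;\cong\bigoplus_{m\in\mathbb Z\cap\left(\left[0,\frac{n-1}{2}\right]\cup\left[n,\frac{p+n-2}{2}\right]\right)}Q(2m-n),$$ and for the index $m=\frac{n-1}{2}$ one has $Q(2m-n)\cong\mathrm{St}$. -/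

import Mathlib

open scoped TensorProduct

universe u v

noncomputable section

namespace FrobeniusKernel

variable (p : ℕ)

/-- The equations of the first Frobenius kernel `G₁` of `G = SL₂` over `𝔽_p`, in the entries
`x i j` of a generic `2 × 2` matrix: `det x = 1` and `(x i j) ^ p = δ i j`. -/
def relations : Set (MvPolynomial (Fin 2 × Fin 2) (ZMod p)) :=
  {(Matrix.mvPolynomialX (Fin 2) (Fin 2) (ZMod p)).det - 1} ∪
    Set.range fun ij : Fin 2 × Fin 2 =>
      MvPolynomial.X ij ^ p - MvPolynomial.C ((1 : Matrix (Fin 2) (Fin 2) (ZMod p)) ij.1 ij.2)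

/-- The coordinate ring `𝔽_p[G₁]`. -/
def Coord : Type :=
  MvPolynomial (Fin 2 × Fin 2) (ZMod p) ⧸ Ideal.span (relations p)

instance : CommRing (Coord p) :=
  inferInstanceAs (CommRing (MvPolynomial (Fin 2 × Fin 2) (ZMod p) ⧸ Ideal.span (relations p)))

instance : Algebra (ZMod p) (Coord p) :=
  inferInstanceAs
    (Algebra (ZMod p) (MvPolynomial (Fin 2 × Fin 2) (ZMod p) ⧸ Ideal.span (relations p)))

/-- The quotient map onto `𝔽_p[G₁]`. -/
def mk : MvPolynomial (Fin 2 × Fin 2) (ZMod p) →ₐ[ZMod p] Coord p :=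
  Ideal.Quotient.mkₐ (ZMod p) (Ideal.span (relations p))

/-- The universal point of `G₁`: the matrix of coordinate functions. -/
def gen : Matrix (Fin 2) (Fin 2) (Coord p) :=
  Matrix.of fun i j => mk p (MvPolynomial.X (i, j))

variable {p}

/-- `g` is a point of `G₁`: a matrix of determinant `1` killed by the Frobenius morphism. -/
def IsPoint {R : Type*} [CommRing R] (p : ℕ) (g : Matrix (Fin 2) (Fin 2) R) : Prop :=
  g.det = 1 ∧ ∀ i j, g i j ^ p = (1 : Matrix (Fin 2) (Fin 2) R) i j

/-- A point `g ∈ G₁(R)` as an algebra homomorphism `𝔽_p[G₁] → R`, `f ↦ f(g)`. -/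
def evalAt {R : Type*} [CommRing R] [Algebra (ZMod p) R] (g : Matrix (Fin 2) (Fin 2) R)
    (hg : IsPoint p g) : Coord p →ₐ[ZMod p] R :=
  Ideal.Quotient.liftₐ (Ideal.span (relations p))
    (MvPolynomial.aeval fun ij : Fin 2 × Fin 2 => g ij.1 ij.2) <| by
      intro a ha
      refine (Ideal.span_le (I := RingHom.ker
        (MvPolynomial.aeval (R := ZMod p) fun ij : Fin 2 × Fin 2 => g ij.1 ij.2))).2 ?_ ha
      rintro f (rfl | ⟨⟨i, j⟩, rfl⟩)
      · have h := hg.1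
        rw [Matrix.det_fin_two] at h
        simp [RingHom.mem_ker, Matrix.det_fin_two, Matrix.mvPolynomialX_apply, h]
      · have h := hg.2 i j
        rw [Matrix.one_apply] at h
        simp only [SetLike.mem_coe, RingHom.mem_ker, map_sub, map_pow, MvPolynomial.aeval_X, h,
          MvPolynomial.aeval_C, Matrix.one_apply]
        split_ifs <;> simp

@[simp]
theorem evalAt_gen {R : Type*} [CommRing R] [Algebra (ZMod p) R] (g : Matrix (Fin 2) (Fin 2) R)
    (hg : IsPoint p g) (i j : Fin 2) : evalAt g hg (gen p i j) = g i j :=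
  (Ideal.Quotient.liftₐ_apply _ _ _ _).trans (MvPolynomial.aeval_X _ _)

theorem hom_ext {R : Type*} [CommRing R] [Algebra (ZMod p) R] {f g : Coord p →ₐ[ZMod p] R}
    (h : ∀ i j, f (gen p i j) = g (gen p i j)) : f = g := by
  refine Ideal.Quotient.algHom_ext (ZMod p) (MvPolynomial.algHom_ext fun ij => ?_)
  exact h ij.1 ij.2

theorem isPoint_gen : IsPoint p (gen p) := by
  constructor
  · have h : mk p ((Matrix.mvPolynomialX (Fin 2) (Fin 2) (ZMod p)).det - 1) = 0 :=
      Ideal.Quotient.eq_zero_iff_mem.2 (Ideal.subset_span (Or.inl rfl))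
    simp only [Matrix.det_fin_two, Matrix.mvPolynomialX_apply, map_sub, map_mul, map_one] at h
    rw [Matrix.det_fin_two]
    exact sub_eq_zero.1 h
  · intro i j
    have h : mk p (MvPolynomial.X (i, j) ^ p -
        MvPolynomial.C ((1 : Matrix (Fin 2) (Fin 2) (ZMod p)) i j)) = 0 :=
      Ideal.Quotient.eq_zero_iff_mem.2 (Ideal.subset_span (Or.inr ⟨(i, j), rfl⟩))
    rw [map_sub, map_pow, sub_eq_zero, ← MvPolynomial.algebraMap_eq, AlgHom.commutes] at h
    refine Eq.trans h ?_
    rw [Matrix.one_apply, Matrix.one_apply]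
    split_ifs <;> simp

theorem IsPoint.map {R S : Type*} [CommRing R] [CommRing S] {g : Matrix (Fin 2) (Fin 2) R}
    (hg : IsPoint p g) (f : R →+* S) : IsPoint p (g.map f) := by
  refine ⟨?_, fun i j => ?_⟩
  · rw [← RingHom.mapMatrix_apply, ← RingHom.map_det, hg.1, map_one]
  · rw [Matrix.map_apply, ← map_pow, hg.2, Matrix.one_apply, Matrix.one_apply]
    split_ifs <;> simp

theorem natCast_eq_zero (R : Type*) [CommRing R] [Algebra (ZMod p) R] : (p : R) = 0 := by
  rw [← map_natCast (algebraMap (ZMod p) R), CharP.cast_eq_zero, map_zero]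

theorem IsPoint.mul [Fact p.Prime] {R : Type*} [CommRing R] [Algebra (ZMod p) R]
    {g h : Matrix (Fin 2) (Fin 2) R} (hg : IsPoint p g) (hh : IsPoint p h) :
    IsPoint p (g * h) := by
  refine ⟨by rw [Matrix.det_mul, hg.1, hh.1, mul_one], fun i j => ?_⟩
  rw [Matrix.mul_apply, Fin.sum_univ_two]
  obtain ⟨r, hr⟩ := exists_add_pow_prime_eq (Fact.out : p.Prime) (g i 0 * h 0 j) (g i 1 * h 1 j)
  rw [hr, natCast_eq_zero R, mul_pow, mul_pow, hg.2, hg.2, hh.2, hh.2]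
  have hij : (1 : Matrix (Fin 2) (Fin 2) R) i j =
      (1 * 1 : Matrix (Fin 2) (Fin 2) R) i j := by
    rw [one_mul]
  rw [hij, Matrix.mul_apply, Fin.sum_univ_two]
  ring

theorem isPoint_one [Fact p.Prime] {R : Type*} [CommRing R] :
    IsPoint p (1 : Matrix (Fin 2) (Fin 2) R) := by
  refine ⟨Matrix.det_one, fun i j => ?_⟩
  rw [Matrix.one_apply]
  split_ifs
  · exact one_pow p
  · exact zero_pow (Fact.out : p.Prime).ne_zero

section
variable [Fact p.Prime]

/-- Comultiplication, dual to the product of matrices: `x i j ↦ ∑ k, x i k ⊗ x k j`. -/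
def comulHom (p : ℕ) [Fact p.Prime] : Coord p →ₐ[ZMod p] Coord p ⊗[ZMod p] Coord p :=
  evalAt
    ((gen p).map (Algebra.TensorProduct.includeLeft : Coord p →ₐ[ZMod p] _).toRingHom *
      (gen p).map (Algebra.TensorProduct.includeRight : Coord p →ₐ[ZMod p] _).toRingHom)
    ((isPoint_gen.map _).mul (isPoint_gen.map _))

/-- Counit: evaluation at the identity matrix. -/
def counitHom (p : ℕ) [Fact p.Prime] : Coord p →ₐ[ZMod p] ZMod p :=
  evalAt 1 isPoint_one

theorem comulHom_gen (i j : Fin 2) :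
    comulHom p (gen p i j) = ∑ k, gen p i k ⊗ₜ[ZMod p] gen p k j := by
  simp [comulHom, Matrix.mul_apply]

theorem counitHom_gen (i j : Fin 2) :
    counitHom p (gen p i j) = (1 : Matrix (Fin 2) (Fin 2) (ZMod p)) i j := by
  simp [counitHom]

instance : Bialgebra (ZMod p) (Coord p) :=
  Bialgebra.ofAlgHom (comulHom p) (counitHom p)
    (hom_ext fun i j => by
      simp [comulHom_gen, TensorProduct.add_tmul, TensorProduct.tmul_add]
      abel)
    (hom_ext fun i j => by
      simp only [AlgHom.comp_apply, comulHom_gen, Fin.sum_univ_two, map_add,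
        Algebra.TensorProduct.map_tmul, counitHom_gen]
      obtain rfl | rfl : i = 0 ∨ i = 1 := by omega
      all_goals simp)
    (hom_ext fun i j => by
      simp only [AlgHom.comp_apply, comulHom_gen, Fin.sum_univ_two, map_add,
        Algebra.TensorProduct.map_tmul, counitHom_gen]
      obtain rfl | rfl : j = 0 ∨ j = 1 := by omega
      all_goals simp)

end

/-- The algebra of distributions `Dist(G₁)`. As `G₁` is finite and infinitesimal, every linear
form on `𝔽_p[G₁]` is a distribution supported at the identity; the product is convolution,
`(μ ν)(f) = (μ ⊗ ν)(Δ f)`. -/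
abbrev Dist (p : ℕ) [Fact p.Prime] : Type :=
  WithConv (Coord p →ₗ[ZMod p] ZMod p)

theorem eps_pow [hp : Fact p.Prime] : (DualNumber.eps : DualNumber (ZMod p)) ^ p = 0 := by
  exact pow_eq_zero_of_le hp.out.two_le DualNumber.eps_pow_two

theorem isPoint_upper [Fact p.Prime] :
    IsPoint p (!![1, DualNumber.eps; 0, 1] : Matrix (Fin 2) (Fin 2) (DualNumber (ZMod p))) := by
  refine ⟨by simp [Matrix.det_fin_two], fun i j => ?_⟩
  fin_cases i <;> fin_cases j <;> simp [eps_pow, (Fact.out : p.Prime).ne_zero]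

theorem isPoint_diag [Fact p.Prime] :
    IsPoint p (!![1 + DualNumber.eps, 0; 0, 1 - DualNumber.eps] :
      Matrix (Fin 2) (Fin 2) (DualNumber (ZMod p))) := by
  have h0 := natCast_eq_zero (p := p) (DualNumber (ZMod p))
  have key : ∀ x : DualNumber (ZMod p), x ^ p = 0 → (1 + x) ^ p = 1 := fun x hx => by
    obtain ⟨r, hr⟩ := exists_add_pow_prime_eq (Fact.out : p.Prime) 1 x
    rw [hr, h0, hx]; simp
  refine ⟨?_, fun i j => ?_⟩
  · rw [Matrix.det_fin_two_of, mul_zero, sub_zero, add_mul, mul_sub, mul_sub,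
      DualNumber.eps_mul_eps]
    ring
  · fin_cases i <;> fin_cases j <;>
      simp [(Fact.out : p.Prime).ne_zero, key _ eps_pow, sub_eq_add_neg,
        key _ (show (-DualNumber.eps : DualNumber (ZMod p)) ^ p = 0 by
          rw [neg_pow, eps_pow, mul_zero])]

/-- The distribution given by a tangent vector `g ∈ G₁(𝔽_p[ε])`: the coefficient of `ε` in
`f(g)`. -/
def tangent [Fact p.Prime] (g : Matrix (Fin 2) (Fin 2) (DualNumber (ZMod p)))
    (hg : IsPoint p g) : Dist p :=
  WithConv.toConv ((TrivSqZeroExt.sndHom (ZMod p) (ZMod p)) ∘ₗ (evalAt g hg).toLinearMap)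

variable (p) [Fact p.Prime]

/-- The element `X` of `Lie(G) ⊆ Dist(G₁)`: the matrix `(0, 1; 0, 0)`. -/
def X : Dist p := tangent _ isPoint_upper

/-- The element `H` of `Lie(T) ⊆ Dist(T₁)`: the matrix `diag(1, -1)`. -/
def H : Dist p := tangent _ isPoint_diag

/-- `binom(H - n, i)` for `i < p`, that is
`(H - n) (H - n - 1) ⋯ (H - n - i + 1) / i!`, where `i!` is invertible in `𝔽_p`. -/
def binomH (n : ℤ) (i : ℕ) : Dist p :=
  ((Nat.factorial i : ZMod p)⁻¹) • Polynomial.aeval (H p - (n : Dist p)) (descPochhammer ℤ i)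

/-- `μ_n = ∑_{i=0}^{p-1} (-1)^i binom(H - n, i)`. -/
def mu (n : ℤ) : Dist p :=
  ∑ i ∈ Finset.range p, (-1) ^ i * binomH p n i

/-- `Dist(G₁) μ_n`, a left ideal, as a `Dist(G₁)`-module. -/
abbrev DistMu (n : ℤ) : Submodule (Dist p) (Dist p) :=
  Submodule.span (Dist p) {mu p n}

/-- The module induced from the one-dimensional `Dist(B₁⁺)`-module `m`, on which `X` acts
by `0` and `H` by `m`: the quotient of `Dist(G₁)` by the left ideal generated by `X` and
`H - m`. -/
abbrev babyVerma (m : ℤ) : Type :=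
  Dist p ⧸ Submodule.span (Dist p) {X p, H p - (m : Dist p)}

/-- The Steinberg module. -/
abbrev Steinberg : Type := babyVerma p ((p : ℤ) - 1)

/-- `L` is a simple `Dist(G₁)`-module of highest weight `m`. -/
def IsSimpleOfHighestWeight (m : ℤ) (L : Type*) [AddCommGroup L] [Module (Dist p) L] : Prop :=
  IsSimpleModule (Dist p) L ∧ ∃ v : L, v ≠ 0 ∧ X p • v = 0 ∧ H p • v = m • v

end FrobeniusKernel

/-- `f : Q → M` is a projective cover: `Q` is projective, `f` is surjective and its kernel is
superfluous. -/
structure IsProjectiveCover {A Q M : Type*} [Ring A] [AddCommGroup Q] [AddCommGroup M]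
    [Module A Q] [Module A M] (f : Q →ₗ[A] M) : Prop where
  projective : Module.Projective A Q
  surjective : Function.Surjective f
  superfluous : ∀ N : Submodule A Q, N ⊔ LinearMap.ker f = ⊤ → N = ⊤

end

/-!
The elements `X`, `Y`, `H` of `Lie(G)` act on the coordinate ring of `G₁` by left-invariant
derivations. As the algebra of distributions acts faithfully there, the relations of the restricted
enveloping algebra of `sl₂` can be read off from the values of these derivations on matrix entries,
`p`-th powers included since the `p`-th power of a derivation is one (`isRestrictedSl2`). That `X`,
`Y`, `H` generate all distributions is dual to the fact that the coordinate ring, a truncated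
polynomial ring, has no proper nonzero ideal stable under these derivations (`eq_bot_of_stable`).
No basis of the algebra of distributions is needed; the existence of all highest weights, for
instance, is witnessed by the powers of the function `x₀₀`.

Over any algebra `A` generated by such elements, a vector `v` killed by `E` and having a weight
generates the submodule of all `q(F) v`, with `q` a polynomial. As `F` is nilpotent, `q(F)` is a
unit if `q(0)` is one, so simple modules are determined by their highest weight
(`nonempty_equiv_of_isHighestWeightVector`), and the one of highest weight `0 ≤ l < p` is spanned by
`F ^ i v` of weight `l - 2 i` for `0 ≤ i ≤ l`. For `l = p - 1` the induced module itself is simple,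
and `v ↦ E ^ (p - 1) F ^ (p - 1) e` splits the projection onto it, so it is projective.

The element `μ_n` is the idempotent `e` projecting to the weight `n` (`isWeightIdempotent_mu`). So
`A e` is projective and homomorphisms from it to `V` are vectors of weight `n` in `V`. Hence `A e` is
a projective cover of the sum of the simple modules, each taken as often as `n` is a weight of it
(`exists_isProjectiveCover_span`). A direct sum of projective covers of these simple modules is
another projective cover of the same module, and projective covers are unique. It remains to list
the pairs `(l, i)` with `l - 2 i` congruent to `n`. Projective covers exist because `A` is Artinian
(`exists_isProjectiveCover`).
-/

/-! ### Projective covers -/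

section ProjectiveCover

variable {A : Type*} [Ring A]

theorem IsProjectiveCover.id (P : Type*) [AddCommGroup P] [Module A P] [Module.Projective A P] :
    IsProjectiveCover (LinearMap.id : P →ₗ[A] P) :=
  ⟨inferInstance, Function.surjective_id, fun N hN => by
    rwa [LinearMap.ker_id, sup_bot_eq] at hN⟩

theorem IsProjectiveCover.equiv_comp {P M M' : Type*} [AddCommGroup P] [AddCommGroup M]
    [AddCommGroup M'] [Module A P] [Module A M] [Module A M'] {f : P →ₗ[A] M}
    (hf : IsProjectiveCover f) (e : M ≃ₗ[A] M') :
    IsProjectiveCover (e.toLinearMap ∘ₗ f) :=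
  ⟨hf.projective, e.surjective.comp hf.surjective, fun N hN => hf.superfluous N <| by
    rwa [LinearEquiv.ker_comp] at hN⟩

/-- Projective covers of the same module are isomorphic. -/
theorem IsProjectiveCover.nonempty_equiv {P P' M : Type*} [AddCommGroup P] [AddCommGroup P']
    [AddCommGroup M] [Module A P] [Module A P'] [Module A M] {f : P →ₗ[A] M} {f' : P' →ₗ[A] M}
    (hf : IsProjectiveCover f) (hf' : IsProjectiveCover f') : Nonempty (P ≃ₗ[A] P') := by
  have := hf.projective
  have := hf'.projective
  obtain ⟨g, hg⟩ := Module.projective_lifting_property f' f hf'.surjective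
  have hg' : ∀ x, f' (g x) = f x := fun x => LinearMap.congr_fun hg x
  have hgs : Function.Surjective g := by
    rw [← LinearMap.range_eq_top]
    refine hf'.superfluous _ (eq_top_iff.2 fun y _ => ?_)
    obtain ⟨x, hx⟩ := hf.surjective (f' y)
    refine Submodule.mem_sup.2 ⟨g x, ⟨x, rfl⟩, y - g x, ?_, by abel⟩
    rw [LinearMap.mem_ker, map_sub, hg', hx, sub_self]
  obtain ⟨s, hs⟩ := Module.projective_lifting_property g LinearMap.id hgs
  have hs' : ∀ y, g (s y) = y := fun y => LinearMap.congr_fun hs y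
  have hss : LinearMap.range s = ⊤ := by
    refine hf.superfluous _ (eq_top_iff.2 fun x _ => ?_)
    refine Submodule.mem_sup.2 ⟨s (g x), ⟨g x, rfl⟩, x - s (g x), ?_, by abel⟩
    rw [LinearMap.mem_ker, map_sub, ← hg' (s _), hs', hg', sub_self]
  refine ⟨LinearEquiv.ofBijective g ⟨fun x y hxy => ?_, hgs⟩⟩
  obtain ⟨x, rfl⟩ := LinearMap.range_eq_top.1 hss x
  obtain ⟨y, rfl⟩ := LinearMap.range_eq_top.1 hss y
  rw [hs', hs'] at hxy
  rw [hxy]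

/-- The image of a superfluous submodule is superfluous. -/
theorem Submodule.eq_top_of_sup_map_eq_top {P P' : Type*} [AddCommGroup P] [AddCommGroup P']
    [Module A P] [Module A P'] {K : Submodule A P} (hK : ∀ N, N ⊔ K = ⊤ → N = ⊤) (g : P →ₗ[A] P')
    (N : Submodule A P') (hN : N ⊔ K.map g = ⊤) : N = ⊤ := by
  have h : N.comap g = ⊤ := hK _ <| eq_top_iff.2 fun x _ => by
    obtain ⟨y, hy, z, ⟨k, hk, rfl⟩, hyz⟩ :=
      Submodule.mem_sup.1 (hN ▸ Submodule.mem_top : g x ∈ N ⊔ K.map g)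
    refine Submodule.mem_sup.2 ⟨x - k, ?_, k, hk, by abel⟩
    rw [Submodule.mem_comap, map_sub, ← hyz, add_sub_cancel_right]
    exact hy
  rwa [sup_eq_left.2] at hN
  exact Submodule.map_le_iff_le_comap.2 (h ▸ le_top)

/-- Finite direct sums of projective covers are projective covers. -/
theorem IsProjectiveCover.directSum {ι : Type*} [Finite ι] [DecidableEq ι] {P M : ι → Type*}
    [∀ i, AddCommGroup (P i)] [∀ i, AddCommGroup (M i)] [∀ i, Module A (P i)]
    [∀ i, Module A (M i)] (f : ∀ i, P i →ₗ[A] M i) (hf : ∀ i, IsProjectiveCover (f i)) :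
    IsProjectiveCover (DirectSum.lmap f) := by
  have := Fintype.ofFinite ι
  have := fun i => (hf i).projective
  refine ⟨inferInstanceAs (Module.Projective A (Π₀ i, P i)),
    (DirectSum.lmap_surjective f).2 fun i => (hf i).surjective, fun N hN => ?_⟩
  have hle : LinearMap.ker (DirectSum.lmap f) ≤
      Finset.univ.sup fun i => (LinearMap.ker (f i)).map (DirectSum.lof A ι P i) := by
    classical
    intro x hx
    rw [← DirectSum.sum_univ_of x]
    refine Submodule.sum_mem _ fun i _ => ?_
    refine (Finset.le_sup (f := fun i => (LinearMap.ker (f i)).map (DirectSum.lof A ι P i))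
      (Finset.mem_univ i)) ⟨x i, ?_, rfl⟩
    have := DFunLike.congr_fun (LinearMap.mem_ker.1 hx) i
    exact this
  have key : ∀ s : Finset ι,
      N ⊔ (s.sup fun i => (LinearMap.ker (f i)).map (DirectSum.lof A ι P i)) = ⊤ → N = ⊤ := by
    intro s
    induction s using Finset.induction_on with
    | empty => simp
    | insert i s _ ih =>
      intro h
      rw [Finset.sup_insert, sup_comm (Submodule.map _ _), ← sup_assoc] at h
      exact ih (Submodule.eq_top_of_sup_map_eq_top (hf i).superfluous _ _ h)
  exact key _ (top_le_iff.1 (hN.symm.le.trans (sup_le_sup_left hle N)))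

/-- A surjection from a finitely generated projective module is a projective cover as soon as its
kernel lies in all maximal submodules. -/
theorem IsProjectiveCover.of_ker_le {P M : Type*} [AddCommGroup P] [AddCommGroup M] [Module A P]
    [Module A M] [Module.Finite A P] [Module.Projective A P] {f : P →ₗ[A] M}
    (hf : Function.Surjective f) (h : ∀ N : Submodule A P, IsCoatom N → LinearMap.ker f ≤ N) :
    IsProjectiveCover f := by
  refine ⟨inferInstance, hf, fun N hN => ?_⟩
  obtain rfl | ⟨N', hN', hle⟩ := eq_top_or_exists_le_coatom N
  · rfl
  · exact (hN'.1 (top_le_iff.1 (hN ▸ sup_le hle (h N' hN')))).elim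

/-- Finitely generated modules over an Artinian ring have projective covers: a finite projective
module of least length among those mapping onto `M` is one, since by Fitting's lemma the eventual
range of an endomorphism of it over `M` is a direct summand mapping onto `M`. -/
theorem exists_isProjectiveCover {A : Type u} [Ring A] [IsArtinianRing A] (M : Type*)
    [AddCommGroup M] [Module A M] [Module.Finite A M] :
    ∃ (P : Type u) (_ : AddCommGroup P) (_ : Module A P) (f : P →ₗ[A] M),
      IsProjectiveCover f := by
  classical
  let S : ℕ → Prop := fun d => ∃ (P : Type u) (_ : AddCommGroup P) (_ : Module A P)
    (f : P →ₗ[A] M), Module.Finite A P ∧ Module.Projective A P ∧ Function.Surjective f ∧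
      Module.length A P = d
  have hex : ∃ d, S d := by
    obtain ⟨n, f, hf⟩ := Module.Finite.exists_fin' A M
    have hfin : IsFiniteLength A (Fin n → A) := by
      rw [isFiniteLength_iff_isNoetherian_isArtinian]
      exact ⟨inferInstance, inferInstance⟩
    obtain ⟨d, hd⟩ := ENat.ne_top_iff_exists.1 (Module.length_ne_top_iff.2 hfin)
    exact ⟨d, Fin n → A, inferInstance, inferInstance, f, inferInstance, inferInstance, hf, hd.symm⟩
  obtain ⟨P, _, _, f, hfin, hproj, hf, hd⟩ := Nat.find_spec hex
  refine ⟨P, _, _, f, hproj, hf, fun N hN => ?_⟩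
  have hfN : Function.Surjective (f ∘ₗ N.subtype) := fun y => by
    obtain ⟨x, rfl⟩ := hf y
    obtain ⟨n, hn, z, hz, rfl⟩ := Submodule.mem_sup.1 (hN ▸ Submodule.mem_top : x ∈ N ⊔ _)
    refine ⟨⟨n, hn⟩, ?_⟩
    rw [map_add, LinearMap.mem_ker.1 hz, add_zero]; rfl
  obtain ⟨g, hg⟩ := Module.projective_lifting_property (f ∘ₗ N.subtype) f hfN
  let φ : Module.End A P := N.subtype ∘ₗ g
  have hφ : ∀ n x, f ((φ ^ n) x) = f x := by
    intro n
    induction n with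
    | zero => intro x; rfl
    | succ n ih =>
      intro x
      rw [pow_succ', Module.End.mul_apply, ← ih x]
      exact LinearMap.congr_fun hg _
  obtain ⟨n, hn⟩ := Filter.eventually_atTop.1 φ.eventually_isCompl_ker_pow_range_pow
  have hc := hn (n + 1) (Nat.le_succ n)
  set R := LinearMap.range (φ ^ (n + 1)) with hR
  have hRproj : Module.Projective A R :=
    Module.Projective.of_split R.subtype (R.projectionOnto _ hc.symm)
      (LinearMap.ext fun x => by simp)
  have hRf : Function.Surjective (f ∘ₗ R.subtype) := fun y => by
    obtain ⟨x, rfl⟩ := hf y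
    exact ⟨⟨_, x, rfl⟩, hφ (n + 1) x⟩
  have hRtop : R = ⊤ := by
    by_contra hne
    have hlt : Module.length A R < Module.length A P :=
      Submodule.length_lt hne
    obtain ⟨d, hd'⟩ := ENat.ne_top_iff_exists.1 (ne_top_of_lt hlt)
    rw [hd, ← hd', Nat.cast_lt] at hlt
    exact Nat.find_min hex hlt ⟨R, _, _, f ∘ₗ R.subtype, inferInstance, hRproj, hRf, hd'.symm⟩
  refine eq_top_iff.2 (hRtop ▸ ?_)
  rw [hR]
  rintro _ ⟨x, rfl⟩
  rw [pow_succ', Module.End.mul_apply]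
  exact (g _).2

end ProjectiveCover

/-! ### Modules over a restricted enveloping algebra of `sl₂` -/

section RestrictedSl2

open Polynomial

/-- The algebra `A` over `𝔽_p` is generated by elements `E`, `F`, `H` satisfying the relations of
the restricted enveloping algebra of `sl₂`. That these are all the relations is not part of the
definition. -/
structure IsRestrictedSl2 (p : ℕ) {A : Type*} [Ring A] [Algebra (ZMod p) A] (E F H : A) :
    Prop where
  H_mul_E : H * E = E * H + 2 * E
  H_mul_F : H * F = F * H - 2 * F
  E_mul_F : E * F = F * E + H
  E_pow : E ^ p = 0
  F_pow : F ^ p = 0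
  H_pow : H ^ p = H
  adjoin_eq_top : Algebra.adjoin (ZMod p) {E, F, H} = ⊤

/-- `v` is a highest weight vector of weight `m`, for `E` raising weights. -/
structure IsHighestWeightVector {A : Type*} [Ring A] (E H : A) (m : ℤ) {V : Type*}
    [AddCommGroup V] [Module A V] (v : V) : Prop where
  ne_zero : v ≠ 0
  E_smul : E • v = 0
  H_smul : H • v = m • v

section Scalars

variable {p : ℕ} {A : Type*} [Ring A] [Algebra (ZMod p) A] {V : Type*} [AddCommGroup V]
  [Module A V]

variable (A) in
include A in
theorem zsmul_eq_zero_of_dvd {c : ℤ} (h : (p : ℤ) ∣ c) (x : V) : c • x = 0 := by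
  rw [← Int.cast_smul_eq_zsmul A, ← map_intCast (algebraMap (ZMod p) A),
    (ZMod.intCast_zmod_eq_zero_iff_dvd c p).2 h, map_zero, zero_smul]

variable (A) in
include A in
theorem zsmul_eq_zsmul_of_dvd {c d : ℤ} (h : (p : ℤ) ∣ c - d) (x : V) : c • x = d • x := by
  rw [← sub_eq_zero, ← sub_smul, zsmul_eq_zero_of_dvd A h]

variable (A) in
include A in
theorem exists_zsmul_zsmul_eq [hp : Fact p.Prime] {c : ℤ} (h : ¬ (p : ℤ) ∣ c) :
    ∃ d : ℤ, ∀ x : V, d • c • x = x := by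
  obtain ⟨a, b, hab⟩ := (Nat.prime_iff_prime_int.1 hp.out).coprime_iff_not_dvd.2 h
  refine ⟨b, fun x => ?_⟩
  rw [← mul_smul]
  conv_rhs => rw [← one_smul ℤ x]
  exact zsmul_eq_zsmul_of_dvd A ⟨-a, by linear_combination hab⟩ x

variable (A) in
include A in
theorem eq_zero_of_zsmul_eq_zero [Fact p.Prime] {c : ℤ} (h : ¬ (p : ℤ) ∣ c) {x : V}
    (hx : c • x = 0) : x = 0 := by
  obtain ⟨d, hd⟩ := exists_zsmul_zsmul_eq (V := V) A h
  rw [← hd x, hx, smul_zero]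

end Scalars

theorem prod_X_sub_C_zmod (p : ℕ) [hp : Fact p.Prime] :
    ∏ c : ZMod p, (X - C c) = X ^ p - X := by
  have hmonic : (X ^ p - X : (ZMod p)[X]).Monic :=
    monic_X_pow_sub (by rw [degree_X]; exact_mod_cast hp.out.one_lt)
  have hroots := FiniteField.roots_X_pow_card_sub_X (ZMod p)
  rw [ZMod.card] at hroots
  have := prod_multiset_X_sub_C_of_monic_of_roots_card_eq hmonic (by
    rw [hroots, FiniteField.X_pow_card_sub_X_natDegree_eq _ hp.out.one_lt, Finset.card_val,
      Finset.card_univ, ZMod.card])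
  rwa [hroots] at this

namespace IsRestrictedSl2

variable {p : ℕ} {A : Type*} [Ring A] [Algebra (ZMod p) A] {E F H : A}
  (hA : IsRestrictedSl2 p E F H) {V : Type*} [AddCommGroup V] [Module A V]

include hA

theorem H_smul_F_pow_smul {m : ℤ} {v : V} (hv : H • v = m • v) (i : ℕ) :
    H • F ^ i • v = (m - 2 * i) • F ^ i • v := by
  induction i with
  | zero => simpa using hv
  | succ i ih =>
    rw [pow_succ', mul_smul, ← mul_smul H, hA.H_mul_F, sub_smul, mul_smul, mul_smul, ih,
      ofNat_smul_eq_nsmul, smul_comm F]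
    generalize F • F ^ i • v = w
    push_cast
    module

theorem H_smul_E_pow_smul {m : ℤ} {v : V} (hv : H • v = m • v) (i : ℕ) :
    H • E ^ i • v = (m + 2 * i) • E ^ i • v := by
  induction i with
  | zero => simpa using hv
  | succ i ih =>
    rw [pow_succ', mul_smul, ← mul_smul H, hA.H_mul_E, add_smul, mul_smul, mul_smul, ih,
      ofNat_smul_eq_nsmul, smul_comm E]
    generalize E • E ^ i • v = w
    push_cast
    module

theorem E_smul_F_pow_succ_smul {m : ℤ} {v : V} (hE : E • v = 0) (hH : H • v = m • v) (i : ℕ) :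
    E • F ^ (i + 1) • v = ((i + 1) * (m - i) : ℤ) • F ^ i • v := by
  induction i with
  | zero => rw [zero_add, pow_one, ← mul_smul, hA.E_mul_F, add_smul, mul_smul, hE, hH]; simp
  | succ i ih =>
    rw [pow_succ', mul_smul, ← mul_smul E, hA.E_mul_F, add_smul, mul_smul, ih,
      hA.H_smul_F_pow_smul hH, smul_comm F, ← mul_smul F, ← pow_succ']
    generalize F ^ (i + 1) • v = w
    push_cast
    module

theorem E_pow_smul_F_pow_smul {m : ℤ} {v : V} (hE : E • v = 0) (hH : H • v = m • v) (i j : ℕ) :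
    E ^ i • F ^ (i + j) • v =
      (∏ t ∈ Finset.range i, ((j + t + 1) * (m - (j + t)) : ℤ)) • F ^ j • v := by
  induction i with
  | zero => simp
  | succ i ih =>
    have h := hA.E_smul_F_pow_succ_smul hE hH (i + j)
    rw [pow_succ, mul_smul, show i + 1 + j = i + j + 1 by ring, h, smul_comm, ih,
      Finset.prod_range_succ, ← mul_smul]
    push_cast
    congr 1
    ring

theorem E_pow_smul_F_pow_smul_of_lt {m : ℤ} {v : V} (hE : E • v = 0) (hH : H • v = m • v)
    {i j : ℕ} (hij : j < i) : E ^ i • F ^ j • v = 0 := by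
  obtain ⟨k, rfl⟩ := Nat.exists_eq_add_of_lt hij
  have h := hA.E_pow_smul_F_pow_smul hE hH j 0
  rw [add_zero, pow_zero, one_smul] at h
  rw [show j + k + 1 = (k + 1) + j by ring, pow_add, mul_smul, h, smul_comm,
    pow_succ, mul_smul, hE, smul_zero, smul_zero]

variable [hp : Fact p.Prime]

omit hA in
theorem not_dvd_prod {l : ℕ} (hl : l < p) {i : ℕ} (hi : i ≤ l) :
    ¬ (p : ℤ) ∣ ∏ t ∈ Finset.range i, ((t + 1) * (l - t) : ℤ) := by
  rw [(Nat.prime_iff_prime_int.1 hp.out).dvd_finsetProd_iff]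
  rintro ⟨t, ht, hdvd⟩
  rw [Finset.mem_range] at ht
  obtain h | h := Int.Prime.dvd_mul' hp.out hdvd
  · exact absurd (Int.le_of_dvd (by omega) h) (by omega)
  · exact absurd (Int.le_of_dvd (by omega) h) (by omega)

/-- The vector `E ^ i F ^ i v` is a nonzero multiple of `v` for `i ≤ l`. -/
theorem exists_E_pow_smul_F_pow_smul {l : ℕ} (hl : l < p) {v : V} (hE : E • v = 0)
    (hH : H • v = (l : ℤ) • v) {i : ℕ} (hi : i ≤ l) :
    ∃ d : ℤ, ¬ (p : ℤ) ∣ d ∧ E ^ i • F ^ i • v = d • v := by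
  refine ⟨_, not_dvd_prod hl hi, ?_⟩
  simpa using hA.E_pow_smul_F_pow_smul hE hH i 0

/-- The additive group of all `q(F) v` is the submodule generated by the vector `v`, if `v` is
killed by `E` and has a weight. -/
theorem exists_aeval_smul_eq {m : ℤ} {v : V} (hE : E • v = 0) (hH : H • v = m • v) (a : A) :
    ∃ q : ℤ[X], a • v = aeval F q • v := by
  have hadd : ∀ x y : V, (∃ q : ℤ[X], x = aeval F q • v) → (∃ q : ℤ[X], y = aeval F q • v) →
      ∃ q : ℤ[X], x + y = aeval F q • v := by
    rintro _ _ ⟨q, rfl⟩ ⟨r, rfl⟩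
    exact ⟨q + r, by rw [map_add, add_smul]⟩
  -- the elements of `A` preserving the group of all `q(F) v` form a subalgebra
  suffices h : ∀ q : ℤ[X], ∃ r : ℤ[X], a • aeval F q • v = aeval F r • v by
    simpa using h 1
  have ha : a ∈ Algebra.adjoin (ZMod p) {E, F, H} := hA.adjoin_eq_top ▸ Algebra.mem_top
  induction ha using Algebra.adjoin_induction with
  | mem x hx =>
    intro q
    induction q using Polynomial.induction_on' with
    | add q r hq hr =>
      rw [map_add, add_smul, smul_add]
      exact hadd _ _ hq hr
    | monomial i c =>
      simp only [aeval_monomial, eq_intCast, mul_smul, Int.cast_smul_eq_zsmul]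
      rw [smul_comm]
      suffices h : ∃ r : ℤ[X], x • F ^ i • v = aeval F r • v by
        obtain ⟨r, hr⟩ := h
        exact ⟨C c * r, by simp [hr, mul_smul, Int.cast_smul_eq_zsmul]⟩
      obtain rfl | rfl | rfl := hx
      · cases i with
        | zero => exact ⟨0, by simp [hE]⟩
        | succ i =>
          rw [hA.E_smul_F_pow_succ_smul hE hH]
          exact ⟨C ((i + 1) * (m - i) : ℤ) * X ^ i, by
            rw [map_mul, aeval_C, map_pow, aeval_X, eq_intCast, mul_smul _ (F ^ i) v,
              Int.cast_smul_eq_zsmul]⟩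
      · exact ⟨X ^ (i + 1), by simp [pow_succ', mul_smul]⟩
      · rw [hA.H_smul_F_pow_smul hH]
        exact ⟨C (m - 2 * i) * X ^ i, by
            rw [map_mul, aeval_C, map_pow, aeval_X, eq_intCast, mul_smul _ (F ^ i) v,
              Int.cast_smul_eq_zsmul]⟩
  | algebraMap c =>
    intro q
    obtain ⟨c, rfl⟩ := ZMod.intCast_surjective c
    exact ⟨C c * q, by simp [mul_smul]⟩
  | add x y _ _ hx hy =>
    intro q
    rw [add_smul]
    exact hadd _ _ (hx q) (hy q)
  | mul x y _ _ hx hy =>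
    intro q
    obtain ⟨r, hr⟩ := hy q
    rw [mul_smul, hr]
    exact hx r

theorem isUnit_aeval {q : ℤ[X]} (hq : ¬ (p : ℤ) ∣ q.coeff 0) : IsUnit (aeval F q) := by
  rw [← X_mul_divX_add q, map_add, map_mul, aeval_X, aeval_C, eq_intCast]
  have hc : Commute F (aeval F q.divX) := by
    simpa using (Commute.all (X : ℤ[X]) q.divX).map (aeval F)
  refine IsNilpotent.isUnit_add_right_of_commute (hc.isNilpotent_mul_right ⟨p, hA.F_pow⟩) ?_
    (Int.commute_cast _ _)
  rw [← map_intCast (algebraMap (ZMod p) A)]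
  refine IsUnit.map _ (isUnit_iff_ne_zero.2 ?_)
  rwa [Ne, ZMod.intCast_zmod_eq_zero_iff_dvd]

theorem exists_weight_vector [Nontrivial V] : ∃ (k : ℤ) (v : V), v ≠ 0 ∧ H • v = k • v := by
  -- `H ^ p - H` is the product of the `H - k`, and it kills all vectors
  by_contra! hcon
  have key : ∀ (s : Multiset ℤ) (v : V), aeval H (s.map fun k => X - C k).prod • v = 0 →
      v = 0 := by
    intro s
    induction s using Multiset.induction_on with
    | empty => simp
    | cons k s ih =>
      intro v hv
      rw [Multiset.map_cons, Multiset.prod_cons, mul_comm, map_mul, mul_smul] at hv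
      by_contra hv0
      refine hcon k v hv0 ?_
      have := ih _ hv
      rwa [map_sub, aeval_X, aeval_C, sub_smul, sub_eq_zero, eq_intCast,
        Int.cast_smul_eq_zsmul] at this
  obtain ⟨v, hv⟩ := exists_ne (0 : V)
  refine hv (key (Multiset.map (fun c : ZMod p => (c.val : ℤ)) Finset.univ.val) v ?_)
  have hprod : ((Multiset.map (fun c : ZMod p => (c.val : ℤ)) Finset.univ.val).map
      fun k => X - C k).prod.map (Int.castRingHom (ZMod p)) = X ^ p - X := by
    rw [Polynomial.map_multiset_prod, Multiset.map_map, Multiset.map_map]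
    rw [← prod_X_sub_C_zmod, Finset.prod]
    congr 1
    refine Multiset.map_congr rfl fun c _ => ?_
    rw [Function.comp_apply, Function.comp_apply, Polynomial.map_sub, map_X, map_C,
      eq_intCast, Int.cast_natCast, ZMod.natCast_val, ZMod.cast_id]
  have : aeval H ((Multiset.map (fun c : ZMod p => (c.val : ℤ)) Finset.univ.val).map
      fun k => X - C k).prod = (0 : A) := by
    rw [← aeval_map_algebraMap (ZMod p), algebraMap_int_eq, hprod]
    simp [hA.H_pow]
  rw [this, zero_smul]

variable (V) in
theorem exists_isHighestWeightVector [Nontrivial V] :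
    ∃ (l : ℕ) (v : V), l < p ∧ IsHighestWeightVector E H l v := by
  obtain ⟨k, w, hw, hH⟩ := hA.exists_weight_vector (V := V)
  have hex : ∃ n, E ^ n • w = 0 := ⟨p, by rw [hA.E_pow, zero_smul]⟩
  classical
  obtain ⟨n, hn⟩ : ∃ n, Nat.find hex = n + 1 :=
    Nat.exists_eq_succ_of_ne_zero fun h => hw <| by
      have := Nat.find_spec hex
      rwa [h, pow_zero, one_smul] at this
  refine ⟨((k + 2 * n) % p).toNat, E ^ n • w, ?_, Nat.find_min hex (by omega), ?_, ?_⟩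
  · have := Int.emod_lt_of_pos (k + 2 * n) (Int.natCast_pos.2 hp.out.pos)
    have := hp.out.pos
    omega
  · rw [← mul_smul, ← pow_succ', ← hn]
    exact Nat.find_spec hex
  · rw [hA.H_smul_E_pow_smul hH]
    refine zsmul_eq_zsmul_of_dvd (p := p) A ?_ _
    rw [Int.toNat_of_nonneg (Int.emod_nonneg _ (by exact_mod_cast hp.out.ne_zero))]
    exact Int.dvd_self_sub_emod

theorem smul_eq_zero_of_smul_eq_zero {L L' : Type*} [AddCommGroup L] [AddCommGroup L']
    [Module A L] [Module A L'] [IsSimpleModule A L'] {m m' : ℤ}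
    (hm : (p : ℤ) ∣ m' - m) {v : L} {v' : L'} (hv : IsHighestWeightVector E H m v)
    (hv' : IsHighestWeightVector E H m' v') {a : A} (ha : a • v = 0) : a • v' = 0 := by
  -- otherwise `b a v' = v'` for some `b`; write `b a (v, v') = q(F) (v, v')`; one of `q(F)` and
  -- `1 - q(F)` is a unit, and both kill a nonzero vector
  by_contra hne
  obtain ⟨b, hb⟩ := IsSimpleModule.toSpanSingleton_surjective A hne v'
  rw [LinearMap.toSpanSingleton_apply, ← mul_smul] at hb
  obtain ⟨q, hq⟩ := hA.exists_aeval_smul_eq (m := m) (v := (v, v')) (by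
    rw [Prod.smul_mk, hv.E_smul, hv'.E_smul]; rfl) (by
    rw [Prod.smul_mk, hv.H_smul, hv'.H_smul, zsmul_eq_zsmul_of_dvd A hm]; rfl) (b * a)
  rw [Prod.smul_mk, Prod.smul_mk, hb, Prod.mk.injEq, mul_smul, ha, smul_zero] at hq
  by_cases h0 : (p : ℤ) ∣ q.coeff 0
  · refine hv'.ne_zero ((hA.isUnit_aeval (q := 1 - q) fun h1 => ?_).smul_eq_zero.1 ?_)
    · rw [coeff_sub, coeff_one_zero] at h1
      exact (Nat.prime_iff_prime_int.1 hp.out).not_dvd_one ((Int.dvd_iff_dvd_of_dvd_sub h1).2 h0)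
    · rw [map_sub, map_one, sub_smul, one_smul, ← hq.2, sub_self]
  · exact hv.ne_zero ((hA.isUnit_aeval h0).smul_eq_zero.1 hq.1.symm)

/-- A simple module is determined by the weight of a highest weight vector. -/
theorem nonempty_equiv_of_isHighestWeightVector {L L' : Type*} [AddCommGroup L] [AddCommGroup L']
    [Module A L] [Module A L'] [IsSimpleModule A L] [IsSimpleModule A L'] {m m' : ℤ}
    (hm : (p : ℤ) ∣ m' - m) {v : L} {v' : L'} (hv : IsHighestWeightVector E H m v)
    (hv' : IsHighestWeightVector E H m' v') : Nonempty (L ≃ₗ[A] L') := by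
  have hker : LinearMap.ker (LinearMap.toSpanSingleton A L v) =
      LinearMap.ker (LinearMap.toSpanSingleton A L' v') := by
    ext a
    exact ⟨hA.smul_eq_zero_of_smul_eq_zero hm hv hv',
      hA.smul_eq_zero_of_smul_eq_zero ((dvd_sub_comm).1 hm) hv' hv⟩
  exact ⟨(LinearMap.quotKerEquivOfSurjective _
      (IsSimpleModule.toSpanSingleton_surjective A hv.ne_zero)).symm ≪≫ₗ
    Submodule.quotEquivOfEq _ _ hker ≪≫ₗ LinearMap.quotKerEquivOfSurjective _
      (IsSimpleModule.toSpanSingleton_surjective A hv'.ne_zero)⟩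

/-- In a simple module of highest weight `l`, where `0 ≤ l < p`, the vector `F ^ (l + 1) v` would
be another highest weight vector. -/
theorem F_pow_succ_smul_eq_zero {L : Type*} [AddCommGroup L] [Module A L] [IsSimpleModule A L]
    {l : ℕ} {v : L} (hv : IsHighestWeightVector E H l v) : F ^ (l + 1) • v = 0 := by
  by_contra hne
  obtain ⟨a, ha⟩ := IsSimpleModule.toSpanSingleton_surjective A hne v
  have hE : E • F ^ (l + 1) • v = 0 := by
    rw [hA.E_smul_F_pow_succ_smul hv.E_smul hv.H_smul, sub_self, mul_zero, zero_smul]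
  obtain ⟨q, hq⟩ := hA.exists_aeval_smul_eq hE (hA.H_smul_F_pow_smul hv.H_smul (l + 1)) a
  rw [LinearMap.toSpanSingleton_apply, hq, ← mul_smul] at ha
  refine hv.ne_zero ((hA.isUnit_aeval (q := 1 - q * X ^ (l + 1)) ?_).smul_eq_zero.1 ?_)
  · rw [coeff_sub, coeff_one_zero, mul_coeff_zero, coeff_X_pow, if_neg (by omega), mul_zero,
      sub_zero]
    exact (Nat.prime_iff_prime_int.1 hp.out).not_dvd_one
  · rw [map_sub, map_one, map_mul, map_pow, aeval_X, sub_smul, ha, one_smul, sub_self]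

theorem exists_smul_eq_sum {m : ℤ} {v : V} (hE : E • v = 0) (hH : H • v = m • v) {k : ℕ}
    (hk : F ^ k • v = 0) (a : A) :
    ∃ c : ℕ → ℤ, a • v = ∑ i ∈ Finset.range k, c i • F ^ i • v := by
  obtain ⟨q, hq⟩ := hA.exists_aeval_smul_eq hE hH a
  refine ⟨q.coeff, ?_⟩
  rw [hq, aeval_eq_sum_range' (n := q.natDegree + 1 + k) (by omega), add_comm (_ + 1),
    Finset.sum_range_add, add_smul, Finset.sum_smul, Finset.sum_smul,
    Finset.sum_eq_zero (s := Finset.range (q.natDegree + 1)), add_zero]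
  · simp only [smul_assoc]
  · intro i _
    rw [smul_assoc, add_comm, pow_add, mul_smul, hk, smul_zero, smul_zero]

end IsRestrictedSl2

/-! ### Weight idempotents and the projective modules they generate -/

/-- `e` acts on modules as the projection onto the space of weight `n` along the other weight
spaces. The last condition makes it the identity on vectors of weight `n`, the second one makes it
vanish on vectors of other weights. -/
structure IsWeightIdempotent {A : Type*} [Ring A] (H e : A) (n : ℤ) : Prop where
  H_mul : H * e = n * e
  mul_H : e * H = n * e
  exists_eq : ∃ r, e = 1 + r * (H - n)

namespace IsWeightIdempotent

variable {p : ℕ} [hp : Fact p.Prime] {A : Type u} [Ring A] {H e : A} {n : ℤ}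
  (he : IsWeightIdempotent H e n) {V : Type*} [AddCommGroup V] [Module A V]

include he

theorem smul_eq_self {w : V} (hw : H • w = n • w) : e • w = w := by
  obtain ⟨r, hr⟩ := he.exists_eq
  rw [hr, add_smul, one_smul, mul_smul, sub_smul, hw, Int.cast_smul_eq_zsmul, sub_self, smul_zero,
    add_zero]

theorem smul_eq_zero [Algebra (ZMod p) A] {k : ℤ} {w : V} (hw : H • w = k • w)
    (hk : ¬ (p : ℤ) ∣ k - n) : e • w = 0 := by
  refine eq_zero_of_zsmul_eq_zero A hk ?_
  rw [sub_smul, sub_eq_zero, ← smul_comm, ← hw, ← mul_smul, he.mul_H, mul_smul,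
    Int.cast_smul_eq_zsmul]

theorem mul_self : e * e = e :=
  he.smul_eq_self (V := A) <| by rw [smul_eq_mul, he.H_mul, ← Int.cast_smul_eq_zsmul A, smul_eq_mul]

theorem projective_span : Module.Projective A (Submodule.span A {e}) := by
  refine Module.Projective.of_split (Submodule.subtype _)
    ((LinearMap.toSpanSingleton A A e).codRestrict _ fun a =>
      Submodule.mem_span_singleton.2 ⟨a, rfl⟩) (LinearMap.ext fun x => Subtype.ext ?_)
  obtain ⟨a, ha⟩ := Submodule.mem_span_singleton.1 x.2
  simp [← ha, mul_assoc, he.mul_self]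

/-- A vector of weight `n` defines a homomorphism from `A e`. -/
theorem exists_linearMap {w : V} (hw : H • w = n • w) :
    ∃ f : Submodule.span A {e} →ₗ[A] V, f ⟨e, Submodule.mem_span_singleton_self e⟩ = w :=
  ⟨LinearMap.toSpanSingleton A V w ∘ₗ Submodule.subtype _, he.smul_eq_self hw⟩

/-- A homomorphism `f` onto `M` from `A e` is a projective cover as soon as `e ↦ x` defines a
homomorphism to `V` that factors through `f`, for all vectors `x` of weight `n` in simple
modules `V`. -/
theorem isProjectiveCover_of_forall_simple {M : Type*} [AddCommGroup M] [Module A M]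
    {f : Submodule.span A {e} →ₗ[A] M} (hf : Function.Surjective f)
    (h : ∀ (V : Type u) [AddCommGroup V] [Module A V] [IsSimpleModule A V] (x : V),
      H • x = n • x → ∀ a : A, a • f ⟨e, Submodule.mem_span_singleton_self e⟩ = 0 → a • x = 0) :
    IsProjectiveCover f := by
  have := he.projective_span
  have : Module.Finite A (Submodule.span A {e}) := Module.Finite.span_singleton A e
  refine IsProjectiveCover.of_ker_le hf fun N hN z hz => ?_
  have : IsSimpleModule A (_ ⧸ N) := isSimpleModule_iff_isCoatom.2 hN
  obtain ⟨a, ha⟩ := Submodule.mem_span_singleton.1 z.2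
  have hz' : z = a • ⟨e, Submodule.mem_span_singleton_self e⟩ := Subtype.ext ha.symm
  have := h (_ ⧸ N) (N.mkQ ⟨e, Submodule.mem_span_singleton_self e⟩) (by
    rw [← map_smul, ← map_zsmul]
    refine congr_arg _ (Subtype.ext ?_)
    simp [he.H_mul]) a (by rw [← map_smul, ← hz']; exact hz)
  rwa [← map_smul, ← hz', Submodule.mkQ_apply, Submodule.Quotient.mk_eq_zero] at this

end IsWeightIdempotent

theorem isHighestWeightVector_mk {A : Type*} [Ring A] {E H : A} {m : ℤ}
    (hI : Submodule.span A {E, H - (m : A)} ≠ ⊤) :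
    IsHighestWeightVector E H m (Submodule.Quotient.mk (p := Submodule.span A {E, H - (m : A)}) 1)
    where
  ne_zero h := hI <| (Ideal.eq_top_iff_one _).2 <| (Submodule.Quotient.mk_eq_zero _).1 h
  E_smul := by
    rw [← Submodule.Quotient.mk_smul, smul_eq_mul, mul_one, Submodule.Quotient.mk_eq_zero]
    exact Submodule.subset_span (Or.inl rfl)
  H_smul := by
    rw [← sub_eq_zero, ← Int.cast_smul_eq_zsmul A, ← sub_smul, ← Submodule.Quotient.mk_smul,
      smul_eq_mul, mul_one, Submodule.Quotient.mk_eq_zero]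
    exact Submodule.subset_span (Or.inr rfl)

namespace IsRestrictedSl2

variable {p : ℕ} [hp : Fact p.Prime] {A : Type u} [Ring A] [Algebra (ZMod p) A] {E F H : A}
  (hA : IsRestrictedSl2 p E F H) {e : A} {n : ℤ} (he : IsWeightIdempotent H e n)

include hA he

/-- The module `A e` is a projective cover of the sum of the simple modules `L s`, provided these
are listed so that the pairs `(l s, i s)` are all those of the highest weight `l` of a simple module
and of the position `i` of the weight `n` among its weights `l, l - 2, …, -l`. The map sends `e`
to the sum of the vectors `F ^ i s • v s`. It is onto, since powers of `E` isolate the summands, in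
order of descending `i s`. -/
theorem exists_isProjectiveCover_span {ι : Type*} [Fintype ι] [DecidableEq ι] {L : ι → Type*}
    [∀ s, AddCommGroup (L s)] [∀ s, Module A (L s)] [∀ s, IsSimpleModule A (L s)] {l i : ι → ℕ}
    {v : ∀ s, L s} (hl : ∀ s, l s < p) (hi : ∀ s, i s ≤ l s) (hinj : Function.Injective i)
    (hv : ∀ s, IsHighestWeightVector E H (l s) (v s))
    (hw : ∀ s, (p : ℤ) ∣ l s - 2 * i s - n)
    (hall : ∀ l' i' : ℕ, l' < p → i' ≤ l' → (p : ℤ) ∣ l' - 2 * i' - n →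
      ∃ s, l s = l' ∧ i s = i') :
    ∃ f : Submodule.span A {e} →ₗ[A] DirectSum ι L, IsProjectiveCover f := by
  set y : DirectSum ι L := ∑ s, DirectSum.lof A ι L s (F ^ i s • v s) with hy
  have hyH : H • y = n • y := by
    rw [hy, Finset.smul_sum, Finset.smul_sum]
    refine Finset.sum_congr rfl fun s _ => ?_
    rw [← map_smul, hA.H_smul_F_pow_smul (hv s).H_smul, ← map_zsmul,
      zsmul_eq_zsmul_of_dvd A (hw s)]
  obtain ⟨f, hf⟩ := he.exists_linearMap hyH
  refine ⟨f, he.isProjectiveCover_of_forall_simple ?_ ?_⟩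
  · have hmem : ∀ d s, p - i s = d → ∀ x, DirectSum.lof A ι L s x ∈ LinearMap.range f := by
      intro d
      induction d using Nat.strong_induction_on with
      | _ d ih =>
        rintro s rfl x
        obtain ⟨c, hc, hEF⟩ := hA.exists_E_pow_smul_F_pow_smul (hl s) (hv s).E_smul (hv s).H_smul
          (hi s)
        have hsum : E ^ i s • y = ∑ t, DirectSum.lof A ι L t (E ^ i s • F ^ i t • v t) := by
          rw [hy, Finset.smul_sum]
          simp only [map_smul]
        have h1 : DirectSum.lof A ι L s (E ^ i s • F ^ i s • v s) ∈ LinearMap.range f := by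
          have h2 : E ^ i s • y ∈ LinearMap.range f := Submodule.smul_mem _ _ ⟨_, hf⟩
          rw [hsum, ← Finset.add_sum_erase _ _ (Finset.mem_univ s)] at h2
          refine (Submodule.add_mem_iff_left _ (Submodule.sum_mem _ fun t ht => ?_)).1 h2
          have hts : i t ≠ i s := fun h => (Finset.ne_of_mem_erase ht) (hinj h)
          obtain h | h := lt_or_gt_of_ne hts
          · rw [hA.E_pow_smul_F_pow_smul_of_lt (hv t).E_smul (hv t).H_smul h, map_zero]
            exact Submodule.zero_mem _
          · have := hl t
            have := hi t
            exact ih (p - i t) (by omega) t rfl _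
        obtain ⟨b, hb⟩ := exists_zsmul_zsmul_eq (V := L s) A hc
        obtain ⟨a, rfl⟩ := IsSimpleModule.toSpanSingleton_surjective A (hv s).ne_zero x
        rw [LinearMap.toSpanSingleton_apply, ← hb (v s), ← hEF, map_smul, map_zsmul]
        exact Submodule.smul_mem _ _ (zsmul_mem h1 b)
    refine LinearMap.range_eq_top.1 (eq_top_iff.2 fun x _ => ?_)
    rw [← DirectSum.sum_univ_of x]
    exact Submodule.sum_mem _ fun s _ => hmem _ s rfl (x s)
  · intro V _ _ _ x hx a ha
    rw [hf] at ha
    have := IsSimpleModule.nontrivial A V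
    obtain ⟨l', w, hl', hw'⟩ := hA.exists_isHighestWeightVector V
    obtain ⟨b, rfl⟩ := IsSimpleModule.toSpanSingleton_surjective A hw'.ne_zero x
    obtain ⟨c, hc⟩ := hA.exists_smul_eq_sum hw'.E_smul hw'.H_smul
      (hA.F_pow_succ_smul_eq_zero hw') b
    rw [LinearMap.toSpanSingleton_apply] at hx ⊢
    rw [← he.smul_eq_self hx, hc, Finset.smul_sum, Finset.smul_sum]
    refine Finset.sum_eq_zero fun j hj => ?_
    rw [Finset.mem_range] at hj
    rw [smul_comm e]
    by_cases hdvd : (p : ℤ) ∣ l' - 2 * j - n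
    · obtain ⟨s, rfl, rfl⟩ := hall l' j hl' (by omega) hdvd
      have h3 : a • F ^ i s • v s = 0 := by
        have hys : DirectSum.component A ι L s y = F ^ i s • v s := by
          rw [hy, map_sum, Finset.sum_eq_single s, DirectSum.component.lof_self]
          · intro t _ hts
            rw [DirectSum.component.of, dif_neg hts]
          · exact fun h => (h (Finset.mem_univ s)).elim
        rw [← hys, ← map_smul, ha, map_zero]
      rw [he.smul_eq_self (by
        rw [hA.H_smul_F_pow_smul hw'.H_smul, zsmul_eq_zsmul_of_dvd A hdvd]), smul_comm,
        ← mul_smul, hA.smul_eq_zero_of_smul_eq_zero (a := a * F ^ i s) (by simp) (hv s) hw'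
          (by rwa [mul_smul]), smul_zero]
    · rw [he.smul_eq_zero (hA.H_smul_F_pow_smul hw'.H_smul j) hdvd, smul_zero, smul_zero]

omit he

/-! ### The Steinberg module -/

/-- For weight `p - 1` no `E ^ i F ^ i v` with `i < p` vanishes, so that all nonzero vectors
generate. -/
theorem isSimpleModule_of_weight_sub_one
    (hI : Submodule.span A {E, H - (((p : ℤ) - 1 : ℤ) : A)} ≠ ⊤) :
    IsSimpleModule A (A ⧸ Submodule.span A {E, H - (((p : ℤ) - 1 : ℤ) : A)}) := by
  have hv := isHighestWeightVector_mk hI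
  set I := Submodule.span A {E, H - (((p : ℤ) - 1 : ℤ) : A)}
  set v := Submodule.Quotient.mk (p := I) 1 with hv_def
  have hp1 : ((p - 1 : ℕ) : ℤ) = (p : ℤ) - 1 := by
    rw [Nat.cast_sub hp.out.one_lt.le, Nat.cast_one]
  have hgen : ∀ x, ∃ a : A, x = a • v := by
    rintro ⟨a⟩
    refine ⟨a, ?_⟩
    rw [hv_def, ← Submodule.Quotient.mk_smul, smul_eq_mul, mul_one]
    rfl
  have key : ∀ N ≤ p, ∀ c : ℕ → ℤ, ∑ i ∈ Finset.range N, c i • F ^ i • v ≠ 0 →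
      ∃ b : A, b • ∑ i ∈ Finset.range N, c i • F ^ i • v = v := by
    intro N
    induction N with
    | zero => simp
    | succ N ih =>
      intro hN c hc
      rw [Finset.sum_range_succ] at hc ⊢
      by_cases hdvd : (p : ℤ) ∣ c N
      · rw [zsmul_eq_zero_of_dvd A hdvd, add_zero] at hc ⊢
        exact ih (by omega) c hc
      · obtain ⟨d, hd, hEF⟩ := hA.exists_E_pow_smul_F_pow_smul (l := p - 1)
          (Nat.sub_lt hp.out.pos one_pos) hv.E_smul (by rw [hp1]; exact hv.H_smul) (i := N) (by omega)
        obtain ⟨b, hb⟩ := exists_zsmul_zsmul_eq (V := A ⧸ I) A hd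
        obtain ⟨b', hb'⟩ := exists_zsmul_zsmul_eq (V := A ⧸ I) A hdvd
        refine ⟨b' • b • E ^ N, ?_⟩
        rw [smul_add, Finset.smul_sum, Finset.sum_eq_zero, zero_add]
        · rw [smul_assoc, smul_assoc, smul_comm _ (c N), hEF, smul_comm b, hb, hb']
        · intro i hi
          rw [smul_comm, smul_assoc, smul_assoc, hA.E_pow_smul_F_pow_smul_of_lt hv.E_smul hv.H_smul
            (Finset.mem_range.1 hi)]
          simp
  rw [isSimpleModule_iff_toSpanSingleton_surjective]
  refine ⟨⟨v, 0, hv.ne_zero⟩, fun x hx y => ?_⟩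
  obtain ⟨a, rfl⟩ := hgen x
  obtain ⟨a', rfl⟩ := hgen y
  obtain ⟨c, hc⟩ := hA.exists_smul_eq_sum (k := p) hv.E_smul hv.H_smul
    (by rw [hA.F_pow, zero_smul]) a
  obtain ⟨b, hb⟩ := key p le_rfl c (hc ▸ hx)
  exact ⟨a' * b, by rw [LinearMap.toSpanSingleton_apply, mul_smul, hc, hb]⟩

/-- The map `v ↦ E ^ (p - 1) F ^ (p - 1) e`, with `e` the projection to the weight `p - 1`, splits
the projection of `A` to the Steinberg module, up to a nonzero scalar. -/
theorem projective_of_weight_sub_one (he : IsWeightIdempotent H e ((p : ℤ) - 1))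
    (hI : Submodule.span A {E, H - (((p : ℤ) - 1 : ℤ) : A)} ≠ ⊤) :
    Module.Projective A (A ⧸ Submodule.span A {E, H - (((p : ℤ) - 1 : ℤ) : A)}) := by
  have hv := isHighestWeightVector_mk hI
  set I := Submodule.span A {E, H - (((p : ℤ) - 1 : ℤ) : A)} with hI_def
  have hp1 : ((p - 1 : ℕ) : ℤ) = (p : ℤ) - 1 := by
    rw [Nat.cast_sub hp.out.one_lt.le, Nat.cast_one]
  obtain ⟨d, hd, hEF⟩ := hA.exists_E_pow_smul_F_pow_smul (l := p - 1)
    (Nat.sub_lt hp.out.pos one_pos) hv.E_smul (by rw [hp1]; exact hv.H_smul) le_rfl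
  obtain ⟨b, hb⟩ := exists_zsmul_zsmul_eq (V := A ⧸ I) A hd
  set w : A := E ^ (p - 1) • F ^ (p - 1) • e with hw
  have hEw : E * w = 0 := by
    rw [hw, smul_eq_mul, ← mul_assoc, ← pow_succ', Nat.sub_add_cancel hp.out.one_lt.le, hA.E_pow,
      zero_mul]
  have hHe : H • e = ((p : ℤ) - 1) • e := by
    rw [smul_eq_mul, he.H_mul, ← Int.cast_smul_eq_zsmul A, smul_eq_mul]
  have hHw : H • w = ((p : ℤ) - 1) • w := by
    rw [hw, hA.H_smul_E_pow_smul (hA.H_smul_F_pow_smul hHe (p - 1)) (p - 1), sub_add_cancel]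
  have hle : I ≤ LinearMap.ker (LinearMap.toSpanSingleton A A (b • w)) := by
    refine Submodule.span_le.2 ?_
    rintro _ (rfl | rfl)
    · rw [SetLike.mem_coe, LinearMap.mem_ker, LinearMap.toSpanSingleton_apply, smul_comm,
        smul_eq_mul, hEw, smul_zero]
    · rw [SetLike.mem_coe, LinearMap.mem_ker, LinearMap.toSpanSingleton_apply, smul_comm,
        sub_smul, hHw, Int.cast_smul_eq_zsmul, sub_self, smul_zero]
  refine Module.Projective.of_split (I.liftQ _ hle) I.mkQ (Submodule.linearMap_qext _ ?_)
  refine LinearMap.ext_ring ?_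
  simp only [LinearMap.comp_apply, Submodule.mkQ_apply, Submodule.liftQ_apply,
    LinearMap.toSpanSingleton_apply, one_smul, LinearMap.id_apply]
  rw [← Submodule.mkQ_apply, map_zsmul, hw, map_smul, map_smul, Submodule.mkQ_apply,
    ← mul_one e, ← smul_eq_mul e, Submodule.Quotient.mk_smul, he.smul_eq_self hv.H_smul, hEF, hb]

end IsRestrictedSl2

end RestrictedSl2

/-! ### Derivations in characteristic `p` -/

section Derivation

variable {k C : Type*} [CommRing k] [CommRing C] [Algebra k C]

/-- In characteristic `p` the `p`-th power of a derivation is a derivation. -/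
def Derivation.powChar (p : ℕ) [hp : Fact p.Prime] [CharP k p] (D : Derivation k C C) :
    Derivation k C C :=
  Derivation.mk' ((D : Module.End k C) ^ p) <| by
    -- `D ∘ μ = μ ∘ (D ⊗ 1 + 1 ⊗ D)` for the multiplication `μ : C ⊗ C → C`
    let T : Module.End k (C ⊗[k] C) := (D : Module.End k C).rTensor C
    let S : Module.End k (C ⊗[k] C) := (D : Module.End k C).lTensor C
    have hTS : Commute T S := by
      refine TensorProduct.ext' fun x y => ?_
      simp [T, S]
    have hD : ∀ n : ℕ, ∀ z, LinearMap.mul' k C (((T + S) ^ n) z) =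
        ((D : Module.End k C) ^ n) (LinearMap.mul' k C z) := by
      intro n
      induction n with
      | zero => intro z; rfl
      | succ n ih =>
        intro z
        rw [pow_succ, pow_succ, Module.End.mul_apply, Module.End.mul_apply, ih]
        congr 1
        induction z with
        | zero => simp
        | add x y hx hy => rw [map_add, map_add, hx, hy, map_add, map_add]
        | tmul x y => simp [T, S]; ring
    obtain ⟨r, hr⟩ := hTS.exists_add_pow_prime_eq hp.out
    have hp0 : ((p : ℕ) : Module.End k (C ⊗[k] C)) = 0 := by
      rw [← _root_.map_natCast (algebraMap k _), CharP.cast_eq_zero, map_zero]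
    rw [hp0, zero_mul, zero_mul, zero_mul, add_zero] at hr
    have hT : ∀ (n : ℕ) (x y : C), (T ^ n) (x ⊗ₜ y) = ((D : Module.End k C) ^ n) x ⊗ₜ[k] y := by
      intro n x y
      simp only [T]
      rw [LinearMap.rTensor_pow, LinearMap.rTensor_tmul]
    have hS : ∀ (n : ℕ) (x y : C), (S ^ n) (x ⊗ₜ y) = x ⊗ₜ[k] ((D : Module.End k C) ^ n) y := by
      intro n x y
      simp only [S]
      rw [LinearMap.lTensor_pow, LinearMap.lTensor_tmul]
    intro x y
    have := hD p (x ⊗ₜ y)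
    rw [hr, LinearMap.add_apply, hT, hS, map_add, LinearMap.mul'_apply, LinearMap.mul'_apply,
      LinearMap.mul'_apply] at this
    rw [← this, smul_eq_mul, smul_eq_mul]
    ring

theorem Derivation.powChar_apply (p : ℕ) [Fact p.Prime] [CharP k p] (D : Derivation k C C)
    (x : C) : D.powChar p x = D^[p] x :=
  Module.End.pow_apply _ _ _

theorem Derivation.iterate_mul_pow {D : Derivation k C C} {s t : C} (hs : D s = 0) (ht : D t = 1)
    (n i : ℕ) : D^[n] (s * t ^ i) = (i.descFactorial n : C) * (s * t ^ (i - n)) := by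
  induction n with
  | zero => simp
  | succ n ih =>
    rw [Function.iterate_succ_apply', ih, D.leibniz, D.map_natCast, D.leibniz, hs, D.leibniz_pow,
      ht, Nat.descFactorial_succ, Nat.sub_sub]
    simp only [smul_eq_mul, nsmul_eq_mul, Nat.cast_mul]
    ring

/-- Coefficients of a truncated polynomial in `t` are recovered by applying `d/dt`. -/
theorem Derivation.mem_of_sum_mul_pow_mem {p : ℕ} [hp : Fact p.Prime] [Algebra (ZMod p) C]
    {D : Derivation k C C} {I : Ideal C} (hI : ∀ x ∈ I, D x ∈ I) {s : ℕ → C} {t : C}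
    (hs : ∀ i, D (s i) = 0) (ht : D t = 1) {N : ℕ} (hN : N ≤ p)
    (hsum : ∑ i ∈ Finset.range N, s i * t ^ i ∈ I) : ∀ i < N, s i ∈ I := by
  induction N with
  | zero => simp
  | succ N ih =>
    have hIt : ∀ n, ∀ x ∈ I, D^[n] x ∈ I := by
      intro n
      induction n with
      | zero => exact fun x hx => hx
      | succ n ih => exact fun x hx => by rw [Function.iterate_succ_apply]; exact ih _ (hI x hx)
    have h := hIt N _ hsum
    have hadd : ∀ (x : ℕ → C) (r : Finset ℕ), D^[N] (∑ i ∈ r, x i) = ∑ i ∈ r, D^[N] (x i) := by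
      intro x r
      have : ∀ y, D^[N] y = ((D : Module.End k C) ^ N) y := fun y => (Module.End.pow_apply _ _ _).symm
      simp only [this, map_sum]
    rw [hadd, Finset.sum_range_succ, Finset.sum_eq_zero, zero_add, iterate_mul_pow (hs N) ht,
      Nat.descFactorial_self, Nat.sub_self, pow_zero, mul_one] at h
    · have hunit : IsUnit ((N.factorial : ℕ) : C) := by
        rw [← _root_.map_natCast (algebraMap (ZMod p) C)]
        refine IsUnit.map _ (isUnit_iff_ne_zero.2 fun h0 => ?_)
        rw [ZMod.natCast_eq_zero_iff, hp.out.dvd_factorial] at h0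
        omega
      have hNI : s N ∈ I := (I.unit_mul_mem_iff_mem hunit).1 h
      rw [Finset.sum_range_succ] at hsum
      have h' := ih (by omega) ((I.add_mem_iff_left (I.mul_mem_right _ hNI)).1 hsum)
      intro i hi
      obtain rfl | hi := Nat.eq_or_lt_of_le (Nat.lt_succ_iff.1 hi)
      · exact hNI
      · exact h' i hi
    · intro i hi
      rw [iterate_mul_pow (hs i) ht, Nat.descFactorial_of_lt (Finset.mem_range.1 hi), Nat.cast_zero,
        zero_mul]

/-- If `t ^ p` lies in an algebra, adjoining `t` gives the polynomials in `t` of degree less than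
`p`. -/
theorem Algebra.exists_eq_sum_of_mem_adjoin_insert {p : ℕ} (hp : 0 < p) {s : Set C} {t : C}
    (ht : t ^ p ∈ Algebra.adjoin k s) {x : C} (hx : x ∈ Algebra.adjoin k (insert t s)) :
    ∃ r : ℕ → C, (∀ i, r i ∈ Algebra.adjoin k s) ∧ x = ∑ i ∈ Finset.range p, r i * t ^ i := by
  let P : AddSubmonoid C :=
    { carrier := {x | ∃ r : ℕ → C, (∀ i, r i ∈ Algebra.adjoin k s) ∧
        x = ∑ i ∈ Finset.range p, r i * t ^ i}
      zero_mem' := ⟨0, fun _ => Subalgebra.zero_mem _, by simp⟩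
      add_mem' := by
        rintro _ _ ⟨r, hr, rfl⟩ ⟨r', hr', rfl⟩
        exact ⟨r + r', fun i => add_mem (hr i) (hr' i), by
          simp [add_mul, Finset.sum_add_distrib]⟩ }
  have hmono : ∀ y ∈ Algebra.adjoin k s, ∀ m : ℕ, y * t ^ m ∈ P := by
    intro y hy m
    refine ⟨Pi.single (m % p) (y * (t ^ p) ^ (m / p)), fun i => ?_, ?_⟩
    · by_cases h : i = m % p
      · subst h
        rw [Pi.single_eq_same]
        exact mul_mem hy (pow_mem ht _)
      · rw [Pi.single_eq_of_ne h]
        exact zero_mem _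
    · rw [Finset.sum_eq_single (m % p), Pi.single_eq_same, mul_assoc, ← pow_mul, ← pow_add,
        Nat.div_add_mod]
      · intro i _ hi
        rw [Pi.single_eq_of_ne hi, zero_mul]
      · exact fun h => (h (Finset.mem_range.2 (Nat.mod_lt _ hp))).elim
  change x ∈ P
  induction hx using Algebra.adjoin_induction with
  | mem y hy =>
    obtain rfl | hy := hy
    · simpa using hmono 1 (one_mem _) 1
    · simpa using hmono y (Algebra.subset_adjoin hy) 0
  | algebraMap c => simpa using hmono _ (Subalgebra.algebraMap_mem _ c) 0
  | add y z _ _ hy hz => exact add_mem hy hz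
  | mul y z _ _ hy hz =>
    obtain ⟨r, hr, rfl⟩ := hy
    obtain ⟨r', hr', rfl⟩ := hz
    rw [Finset.sum_mul_sum]
    refine sum_mem fun i _ => sum_mem fun j _ => ?_
    rw [show r i * t ^ i * (r' j * t ^ j) = r i * r' j * t ^ (i + j) by ring]
    exact hmono _ (mul_mem (hr i) (hr' j)) _

end Derivation

noncomputable section

namespace FrobeniusKernel

/-! ### The action of distributions on the coordinate ring -/

section Action

variable {p : ℕ} [hp : Fact p.Prime]

/-- The linear map `f ⊗ g ↦ μ(g) f`. -/
def contractRight (μ : Dist p) : Coord p ⊗[ZMod p] Coord p →ₗ[ZMod p] Coord p :=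
  (TensorProduct.rid (ZMod p) (Coord p)).toLinearMap ∘ₗ μ.ofConv.lTensor (Coord p)

@[simp]
theorem contractRight_tmul (μ : Dist p) (f g : Coord p) :
    contractRight μ (f ⊗ₜ g) = μ g • f := by
  simp [contractRight]

/-- The left-invariant operator `f ↦ (id ⊗ μ)(Δ f)` on `𝔽_p[G₁]`; this is an action of the algebra
of distributions. -/
def translate (p : ℕ) [Fact p.Prime] : Dist p →ₐ[ZMod p] Module.End (ZMod p) (Coord p) :=
  AlgHom.ofLinearMap
    { toFun := fun μ => contractRight μ ∘ₗ Coalgebra.comul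
      map_add' := fun μ ν => by
        rw [← LinearMap.add_comp]
        congr 1
        refine TensorProduct.ext' fun x y => ?_
        simp [add_smul]
      map_smul' := fun c μ => by
        rw [RingHom.id_apply, ← LinearMap.smul_comp]
        congr 1
        refine TensorProduct.ext' fun x y => ?_
        simp [mul_smul] }
    (by
      refine LinearMap.ext fun f => ?_
      change contractRight 1 (Coalgebra.comul f) = f
      have h : contractRight (1 : Dist p) = (TensorProduct.rid (ZMod p) (Coord p)).toLinearMap ∘ₗ
          Coalgebra.counit.lTensor (Coord p) := by
        refine TensorProduct.ext' fun x y => ?_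
        simp
      rw [h, LinearMap.comp_apply, Coalgebra.lTensor_counit_comul]
      simp)
    (by
      intro μ ν
      refine LinearMap.ext fun f => ?_
      change contractRight (μ * ν) (Coalgebra.comul f) =
        contractRight μ (Coalgebra.comul (contractRight ν (Coalgebra.comul f)))
      have h1 : ∀ z : Coord p ⊗[ZMod p] Coord p, contractRight (μ * ν) z =
          contractRight μ (((contractRight ν).lTensor (Coord p))
            ((Coalgebra.comul.lTensor (Coord p)) z)) := by
        intro z
        induction z with
        | zero => simp
        | add x y hx hy => simp only [map_add, hx, hy]
        | tmul x y =>
          rw [LinearMap.lTensor_tmul, LinearMap.lTensor_tmul, contractRight_tmul,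
            contractRight_tmul, LinearMap.convMul_apply]
          congr 1
          generalize (Coalgebra.comul y : Coord p ⊗[ZMod p] Coord p) = w
          induction w with
          | zero => simp
          | add x y hx hy => simp only [map_add, hx, hy]
          | tmul x y => simp [mul_comm]
      have h2 : ∀ z : Coord p ⊗[ZMod p] Coord p, Coalgebra.comul (contractRight ν z) =
          ((contractRight ν).lTensor (Coord p)) (TensorProduct.assoc (ZMod p) _ _ _
            ((Coalgebra.comul.rTensor (Coord p)) z)) := by
        intro z
        induction z with
        | zero => simp
        | add x y hx hy => simp only [map_add, hx, hy]
        | tmul x y =>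
          rw [contractRight_tmul, LinearMap.rTensor_tmul, map_smul]
          generalize (Coalgebra.comul x : Coord p ⊗[ZMod p] Coord p) = w
          induction w with
          | zero => simp
          | add x y hx hy => simp only [smul_add, TensorProduct.add_tmul, map_add, hx, hy]
          | tmul x y => simp
      rw [h1, h2, Coalgebra.coassoc_apply])

theorem translate_apply (μ : Dist p) (f : Coord p) :
    translate p μ f = contractRight μ (Coalgebra.comul f) := rfl

theorem counit_translate (μ : Dist p) (f : Coord p) :
    Coalgebra.counit (R := ZMod p) (translate p μ f) = μ f := by
  have h : ∀ z : Coord p ⊗[ZMod p] Coord p, Coalgebra.counit (R := ZMod p) (contractRight μ z) =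
      μ (TensorProduct.lid (ZMod p) _ ((Coalgebra.counit.rTensor (Coord p)) z)) := by
    intro z
    induction z with
    | zero => simp
    | add x y hx hy => simp only [map_add, hx, hy]
    | tmul x y => simp [mul_comm]
  rw [translate_apply, h, Coalgebra.rTensor_counit_comul]
  simp

theorem translate_injective : Function.Injective (translate p) := by
  intro μ ν h
  refine WithConv.ext (LinearMap.ext fun f => ?_)
  rw [← counit_translate μ f, h, counit_translate]

theorem comul_gen (i j : Fin 2) : Coalgebra.comul (R := ZMod p) (gen p i j) =
    ∑ k, gen p i k ⊗ₜ[ZMod p] gen p k j :=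
  comulHom_gen i j

theorem translate_gen (μ : Dist p) (i j : Fin 2) :
    translate p μ (gen p i j) = ∑ k, μ (gen p k j) • gen p i k := by
  rw [translate_apply, comul_gen, map_sum]
  simp

/-- A point derivation at the identity acts by a derivation. -/
def translateDerivation (μ : Dist p) (hμ : ∀ f g : Coord p, μ (f * g) =
      μ f * Coalgebra.counit (R := ZMod p) g + Coalgebra.counit (R := ZMod p) f * μ g) :
    Derivation (ZMod p) (Coord p) (Coord p) :=
  Derivation.mk' (translate p μ) <| by
    have key : ∀ z w : Coord p ⊗[ZMod p] Coord p, contractRight μ (z * w) =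
        contractRight μ z * contractRight 1 w + contractRight 1 z * contractRight μ w := by
      intro z w
      induction z with
      | zero => simp
      | add x y hx hy => simp only [add_mul, map_add, hx, hy]; abel
      | tmul x y =>
        induction w with
        | zero => simp
        | add x y hx hy => simp only [mul_add, map_add, hx, hy]; abel
        | tmul x' y' =>
          have h1 : ∀ g : Coord p, (1 : Dist p) g = Coalgebra.counit (R := ZMod p) g :=
            fun g => rfl
          rw [Algebra.TensorProduct.tmul_mul_tmul]
          simp only [contractRight_tmul, hμ, h1, Algebra.smul_def, map_add, map_mul]
          ring
    intro f g
    have h1 : ∀ f : Coord p, contractRight 1 (Coalgebra.comul f) = f := fun f => by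
      rw [← translate_apply, map_one]; rfl
    rw [translate_apply, Bialgebra.comul_mul, key, h1, h1, translate_apply, translate_apply,
      smul_eq_mul, smul_eq_mul]
    ring

theorem tangent_mul {g : Matrix (Fin 2) (Fin 2) (DualNumber (ZMod p))} (hg : IsPoint p g)
    (h1 : ∀ i j, (g i j).fst = (1 : Matrix (Fin 2) (Fin 2) (ZMod p)) i j) (f f' : Coord p) :
    tangent g hg (f * f') = tangent g hg f * Coalgebra.counit (R := ZMod p) f' +
      Coalgebra.counit (R := ZMod p) f * tangent g hg f' := by
  have hfst : ∀ f, (evalAt g hg f).fst = Coalgebra.counit (R := ZMod p) f := by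
    have : (TrivSqZeroExt.fstHom (ZMod p) (ZMod p) (ZMod p)).comp (evalAt g hg) =
        counitHom p := hom_ext fun i j => by
      rw [AlgHom.comp_apply, evalAt_gen, counitHom_gen]
      exact h1 i j
    exact fun f => DFunLike.congr_fun this f
  change (evalAt g hg (f * f')).snd = (evalAt g hg f).snd * _ + _ * (evalAt g hg f').snd
  rw [map_mul, TrivSqZeroExt.snd_mul, hfst, hfst, smul_eq_mul, op_smul_eq_mul]
  ring

theorem tangent_gen {g : Matrix (Fin 2) (Fin 2) (DualNumber (ZMod p))} (hg : IsPoint p g)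
    (i j : Fin 2) : tangent g hg (gen p i j) = (g i j).snd :=
  congr_arg TrivSqZeroExt.snd (evalAt_gen g hg i j)

theorem isPoint_lower (p : ℕ) [Fact p.Prime] :
    IsPoint p (!![1, 0; DualNumber.eps, 1] : Matrix (Fin 2) (Fin 2) (DualNumber (ZMod p))) := by
  refine ⟨by simp [Matrix.det_fin_two], fun i j => ?_⟩
  fin_cases i <;> fin_cases j <;> simp [eps_pow, (Fact.out : p.Prime).ne_zero]

variable (p)

/-- The element `(0, 0; 1, 0)` of `Lie(G) ⊆ Dist(G₁)`. -/
def Y : Dist p := tangent _ (isPoint_lower p)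

/-- `X` as an invariant derivation of the coordinate ring. -/
def derX : Derivation (ZMod p) (Coord p) (Coord p) :=
  translateDerivation (X p) <| tangent_mul _ fun i j => by fin_cases i <;> fin_cases j <;> simp

/-- `Y` as an invariant derivation of the coordinate ring. -/
def derY : Derivation (ZMod p) (Coord p) (Coord p) :=
  translateDerivation (Y p) <| tangent_mul _ fun i j => by fin_cases i <;> fin_cases j <;> simp

/-- `H` as an invariant derivation of the coordinate ring. -/
def derH : Derivation (ZMod p) (Coord p) (Coord p) :=
  translateDerivation (H p) <| tangent_mul _ fun i j => by fin_cases i <;> fin_cases j <;> simp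

theorem translate_X (f : Coord p) : translate p (X p) f = derX p f := rfl

theorem translate_Y (f : Coord p) : translate p (Y p) f = derY p f := rfl

theorem translate_H (f : Coord p) : translate p (H p) f = derH p f := rfl

variable {p}

@[simp]
theorem derX_gen_zero (i : Fin 2) : derX p (gen p i 0) = 0 := by
  rw [← translate_X, translate_gen, X, Fin.sum_univ_two, tangent_gen, tangent_gen]
  simp

@[simp]
theorem derX_gen_one (i : Fin 2) : derX p (gen p i 1) = gen p i 0 := by
  rw [← translate_X, translate_gen, X, Fin.sum_univ_two, tangent_gen, tangent_gen]
  simp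

@[simp]
theorem derY_gen_zero (i : Fin 2) : derY p (gen p i 0) = gen p i 1 := by
  rw [← translate_Y, translate_gen, Y, Fin.sum_univ_two, tangent_gen, tangent_gen]
  simp

@[simp]
theorem derY_gen_one (i : Fin 2) : derY p (gen p i 1) = 0 := by
  rw [← translate_Y, translate_gen, Y, Fin.sum_univ_two, tangent_gen, tangent_gen]
  simp

@[simp]
theorem derH_gen_zero (i : Fin 2) : derH p (gen p i 0) = gen p i 0 := by
  rw [← translate_H, translate_gen, H, Fin.sum_univ_two, tangent_gen, tangent_gen]
  simp

@[simp]
theorem derH_gen_one (i : Fin 2) : derH p (gen p i 1) = -gen p i 1 := by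
  rw [← translate_H, translate_gen, H, Fin.sum_univ_two, tangent_gen, tangent_gen]
  simp

end Action

section Coordinates

variable (p : ℕ) [hp : Fact p.Prime]

/-! ### Generators of the coordinate ring -/

theorem adjoin_range_gen :
    Algebra.adjoin (ZMod p) (Set.range fun ij : Fin 2 × Fin 2 => gen p ij.1 ij.2) = ⊤ := by
  have hs : Function.Surjective (mk p) := Ideal.Quotient.mkₐ_surjective _ _
  have : (Set.range fun ij : Fin 2 × Fin 2 => gen p ij.1 ij.2) =
      mk p '' Set.range (MvPolynomial.X (R := ZMod p)) := by
    rw [← Set.range_comp]; rfl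
  rw [this, Algebra.adjoin_image, MvPolynomial.adjoin_range_X, Algebra.map_top,
    (AlgHom.range_eq_top _).2 hs]

omit hp in
theorem gen_zero_zero_pow : gen p 0 0 ^ p = 1 := (isPoint_gen.2 0 0).trans (by simp)

omit hp in
theorem gen_one_zero_pow : gen p 1 0 ^ p = 0 := (isPoint_gen.2 1 0).trans (by simp)

omit hp in
theorem gen_zero_one_pow : gen p 0 1 ^ p = 0 := (isPoint_gen.2 0 1).trans (by simp)

theorem gen_zero_zero_mul_pow : gen p 0 0 * gen p 0 0 ^ (p - 1) = 1 := by
  rw [← pow_succ', Nat.sub_add_cancel hp.out.one_lt.le, gen_zero_zero_pow]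

omit hp in
theorem gen_det : gen p 0 0 * gen p 1 1 - gen p 0 1 * gen p 1 0 = 1 := by
  rw [← Matrix.det_fin_two]
  exact isPoint_gen.1

theorem derivation_ext {D D' : Derivation (ZMod p) (Coord p) (Coord p)}
    (h0 : ∀ i, D (gen p i 0) = D' (gen p i 0)) (h1 : ∀ i, D (gen p i 1) = D' (gen p i 1)) :
    D = D' := by
  refine Derivation.ext_of_adjoin_eq_top _ (adjoin_range_gen p) ?_
  rintro _ ⟨⟨i, j⟩, rfl⟩
  fin_cases j
  · exact h0 i
  · exact h1 i

theorem adjoin_gen_eq_top : Algebra.adjoin (ZMod p)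
    {gen p 0 1 * gen p 0 0 ^ (p - 1), gen p 1 0, gen p 0 0} = ⊤ := by
  set S := Algebra.adjoin (ZMod p) {gen p 0 1 * gen p 0 0 ^ (p - 1), gen p 1 0, gen p 0 0}
  have hu : gen p 0 1 * gen p 0 0 ^ (p - 1) ∈ S := Algebra.subset_adjoin (by simp)
  have hc : gen p 1 0 ∈ S := Algebra.subset_adjoin (by simp)
  have ha : gen p 0 0 ∈ S := Algebra.subset_adjoin (by simp)
  have hb : gen p 0 1 ∈ S := by
    have : gen p 0 1 = gen p 0 1 * gen p 0 0 ^ (p - 1) * gen p 0 0 := by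
      linear_combination (-gen p 0 1) * gen_zero_zero_mul_pow p
    rw [this]
    exact mul_mem hu ha
  have hd : gen p 1 1 ∈ S := by
    have : gen p 1 1 = gen p 0 0 ^ (p - 1) * (1 + gen p 0 1 * gen p 1 0) := by
      linear_combination (-gen p 1 1) * gen_zero_zero_mul_pow p +
        gen p 0 0 ^ (p - 1) * gen_det p
    rw [this]
    exact mul_mem (pow_mem ha _) (add_mem (one_mem _) (mul_mem hb hc))
  refine top_le_iff.1 ((adjoin_range_gen p).symm.le.trans (Algebra.adjoin_le ?_))
  rintro _ ⟨⟨i, j⟩, rfl⟩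
  fin_cases i <;> fin_cases j
  exacts [ha, hb, hc, hd]

instance finite_coord : Module.Finite (ZMod p) (Coord p) := by
  have h1 : Algebra.FiniteType (ZMod p) (Coord p) :=
    Algebra.FiniteType.of_surjective (mk p) (Ideal.Quotient.mkₐ_surjective _ _)
  have h2 : Algebra.IsIntegral (ZMod p) (Coord p) := by
    suffices h : Algebra.adjoin (ZMod p) (Set.range fun ij : Fin 2 × Fin 2 => gen p ij.1 ij.2) ≤
        integralClosure (ZMod p) (Coord p) from
      ⟨fun f => h (by rw [adjoin_range_gen]; trivial)⟩
    rw [Algebra.adjoin_le_iff]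
    rintro _ ⟨⟨i, j⟩, rfl⟩
    refine IsIntegral.of_pow hp.out.pos ?_
    rw [isPoint_gen.2 i j, Matrix.one_apply]
    split_ifs
    · exact isIntegral_one
    · exact isIntegral_zero
  exact Algebra.IsIntegral.finite

instance finite_dist : Module.Finite (ZMod p) (Dist p) :=
  Module.Finite.equiv (WithConv.linearEquiv (ZMod p) (Coord p →ₗ[ZMod p] ZMod p)).symm

instance isArtinianRing_dist : IsArtinianRing (Dist p) := IsArtinianRing.of_finite (ZMod p) _

instance nontrivial_coord : Nontrivial (Coord p) := (counitHom p).toRingHom.domain_nontrivial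

/-! ### Ideals stable under the invariant derivations -/

variable {p} in
/-- In the coordinates `a = x₀₀`, `c = x₁₀`, `u = x₀₁ / x₀₀` every function is a polynomial
of degree less than `p` in each variable. The derivations `X`, `a Y - x₀₁ H` and `a⁻¹ H` act on
functions of `(a, c, u)`, of `(a, c)`, and of `a`, as the partial derivatives by the last
coordinate, so that a proper stable ideal contains no nonzero function. -/
theorem eq_bot_of_stable {I : Ideal (Coord p)} (hI : I ≠ ⊤) (hX : ∀ f ∈ I, derX p f ∈ I)
    (hY : ∀ f ∈ I, derY p f ∈ I) (hH : ∀ f ∈ I, derH p f ∈ I) : I = ⊥ := by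
  refine (Submodule.eq_bot_iff _).2 fun f hf => ?_
  set a := gen p 0 0 with ha
  set b := gen p 0 1 with hb
  set c := gen p 1 0 with hc
  set d := gen p 1 1 with hd
  have haa : a * a ^ (p - 1) = 1 := gen_zero_zero_mul_pow p
  obtain ⟨r, hr, hfr⟩ := Algebra.exists_eq_sum_of_mem_adjoin_insert (k := ZMod p) (s := {c, a})
    (t := b * a ^ (p - 1)) hp.out.pos
    (by rw [mul_pow, hb, gen_zero_one_pow, zero_mul]; exact zero_mem _)
    (x := f) (by rw [adjoin_gen_eq_top]; trivial)
  have hDX : ∀ g ∈ Algebra.adjoin (ZMod p) {c, a}, derX p g = 0 := by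
    have : Set.EqOn (derX p) (0 : Derivation (ZMod p) (Coord p) (Coord p)) {c, a} := by
      rintro _ (rfl | rfl) <;> simp [hc, ha]
    exact fun g hg => Derivation.eqOn_adjoin this hg
  set D : Derivation (ZMod p) (Coord p) (Coord p) := a • derY p - b • derH p with hD
  have hDI : ∀ g ∈ I, D g ∈ I := fun g hg =>
    I.sub_mem (I.mul_mem_left _ (hY g hg)) (I.mul_mem_left _ (hH g hg))
  have hDa : ∀ g ∈ Algebra.adjoin (ZMod p) {a}, D g = 0 := by
    have : Set.EqOn D (0 : Derivation (ZMod p) (Coord p) (Coord p)) {a} := by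
      rintro _ rfl
      simp [hD, ha, hb, mul_comm]
    exact fun g hg => Derivation.eqOn_adjoin this hg
  set D' : Derivation (ZMod p) (Coord p) (Coord p) := a ^ (p - 1) • derH p with hD'
  rw [hfr] at hf ⊢
  refine Finset.sum_eq_zero fun i hi => ?_
  have hri : r i ∈ I := by
    refine Derivation.mem_of_sum_mul_pow_mem (p := p) hX (fun i => hDX _ (hr i)) ?_ le_rfl hf i
      (Finset.mem_range.1 hi)
    rw [Derivation.leibniz, hDX _ (pow_mem (Algebra.subset_adjoin (by simp)) _), hb,
      derX_gen_one, smul_zero, zero_add, smul_eq_mul, mul_comm, haa]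
  obtain ⟨s, hs, hrs⟩ := Algebra.exists_eq_sum_of_mem_adjoin_insert hp.out.pos
    (by rw [hc, gen_one_zero_pow]; exact zero_mem _) (hr i)
  rw [hrs] at hri ⊢
  rw [Finset.sum_eq_zero, zero_mul]
  intro j hj
  have hsj : s j ∈ I := by
    refine Derivation.mem_of_sum_mul_pow_mem (p := p) hDI (fun i => hDa _ (hs i)) ?_ le_rfl hri j
      (Finset.mem_range.1 hj)
    simp only [hD, hc, Derivation.sub_apply, Derivation.smul_apply, derY_gen_zero, derH_gen_zero,
      smul_eq_mul]
    exact gen_det p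
  obtain ⟨t, ht, hst⟩ := Algebra.exists_eq_sum_of_mem_adjoin_insert (k := ZMod p) (s := ∅)
    (t := a) hp.out.pos
    (by rw [ha, gen_zero_zero_pow]; exact one_mem _) (x := s j) (by
      rw [insert_empty_eq]; exact hs j)
  rw [hst] at hsj ⊢
  rw [Finset.sum_eq_zero, zero_mul]
  intro m hm
  have ht' : ∀ m, ∃ α : ZMod p, algebraMap (ZMod p) (Coord p) α = t m := fun m => by
    have := ht m
    rwa [Algebra.adjoin_empty, Algebra.mem_bot] at this
  have htm : t m ∈ I := by
    refine Derivation.mem_of_sum_mul_pow_mem (p := p) (D := D')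
      (fun g hg => I.mul_mem_left _ (hH g hg)) (fun i => ?_) ?_ le_rfl hsj m
      (Finset.mem_range.1 hm)
    · obtain ⟨α, hα⟩ := ht' i
      rw [← hα, Derivation.map_algebraMap]
    · rw [hD', Derivation.smul_apply, ha, derH_gen_zero, smul_eq_mul, mul_comm]
      exact haa
  obtain ⟨α, hα⟩ := ht' m
  by_cases h0 : α = 0
  · rw [← hα, h0, map_zero, zero_mul]
  · exact (hI (Ideal.eq_top_of_isUnit_mem _ (hα ▸ htm)
      ((isUnit_iff_ne_zero.2 h0).map _))).elim

/-- The functions killed by the algebra generated by `X`, `Y`, `H` generate a proper ideal stable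
under the invariant derivations. So there are none, and this algebra is the whole dual of the
coordinate ring. -/
theorem adjoin_eq_top : Algebra.adjoin (ZMod p) {X p, Y p, H p} = (⊤ : Subalgebra _ (Dist p)) := by
  set B := Algebra.adjoin (ZMod p) {X p, Y p, H p} with hB
  set J : Set (Coord p) := {f | ∀ β ∈ B, β f = 0} with hJ
  have hJB : ∀ β ∈ B, ∀ f ∈ J, translate p β f ∈ J := by
    intro β hβ f hf γ hγ
    rw [← counit_translate, ← Module.End.mul_apply, ← map_mul, counit_translate]
    exact hf _ (mul_mem hγ hβ)
  have hstable : ∀ D : Derivation (ZMod p) (Coord p) (Coord p), (∀ f ∈ J, D f ∈ J) →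
      ∀ f ∈ Ideal.span J, D f ∈ Ideal.span J := by
    intro D hD f hf
    induction hf using Submodule.span_induction with
    | mem x hx => exact Ideal.subset_span (hD x hx)
    | zero => rw [D.map_zero]; exact zero_mem _
    | add x y _ _ hx hy => rw [D.map_add]; exact add_mem hx hy
    | smul r x hx hDx =>
      rw [smul_eq_mul, D.leibniz]
      exact add_mem (Ideal.mul_mem_left _ _ hDx) (Ideal.mul_mem_right _ _ hx)
  have hbot : Ideal.span J = ⊥ := by
    refine eq_bot_of_stable (fun htop => ?_) (hstable _ (hJB _ (Algebra.subset_adjoin (by simp))))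
      (hstable _ (hJB _ (Algebra.subset_adjoin (by simp))))
      (hstable _ (hJB _ (Algebra.subset_adjoin (by simp))))
    have hle : Ideal.span J ≤ RingHom.ker (counitHom p) := Ideal.span_le.2 fun f hf =>
      hf 1 (one_mem _)
    exact one_ne_zero ((map_one (counitHom p)).symm.trans
      (hle ((Ideal.eq_top_iff_one _).1 htop)))
  set W : Subspace (ZMod p) (Module.Dual (ZMod p) (Coord p)) :=
    (Subalgebra.toSubmodule B).map (WithConv.linearEquiv (ZMod p) _).toLinearMap with hW
  have hWbot : W.dualCoannihilator = ⊥ := by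
    refine (Submodule.eq_bot_iff _).2 fun f hf => ?_
    rw [Submodule.mem_dualCoannihilator] at hf
    have : f ∈ Ideal.span J := Ideal.subset_span fun β hβ => hf _ ⟨β, hβ, rfl⟩
    rwa [hbot] at this
  have hWtop : W = ⊤ := by
    rw [← Subspace.dualCoannihilator_dualAnnihilator_eq (W := W), hWbot,
      Submodule.dualAnnihilator_bot]
  refine eq_top_iff.2 fun μ _ => ?_
  obtain ⟨β, hβ, h⟩ : μ.ofConv ∈ W := hWtop ▸ Submodule.mem_top
  rwa [← WithConv.ofConv_injective h]

/-! ### The relations of the restricted enveloping algebra -/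

theorem isRestrictedSl2 : IsRestrictedSl2 p (X p) (Y p) (H p) := by
  have ext_der : ∀ (μ : Dist p) (D D' : Derivation (ZMod p) (Coord p) (Coord p)),
      D = D' → (∀ f, translate p μ f = D f - D' f) → μ = 0 := by
    rintro μ D _ rfl h
    refine translate_injective (LinearMap.ext fun f => ?_)
    rw [h, sub_self, map_zero, LinearMap.zero_apply]
  have hpow : ∀ (μ : Dist p) (D : Derivation (ZMod p) (Coord p) (Coord p)),
      (∀ f, translate p μ f = D f) → ∀ f, translate p (μ ^ p) f = D.powChar p f := by
    intro μ D h f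
    rw [Derivation.powChar_apply, map_pow, Module.End.pow_apply]
    exact congr_arg (fun g : Coord p → Coord p => g^[p] f) (funext h)
  have hp1 : ∀ (D : Derivation (ZMod p) (Coord p) (Coord p)) (f g : Coord p), D f = g → D g = 0 →
      D^[p] f = 0 := by
    intro D f g h1 h2
    obtain ⟨n, hn⟩ := Nat.exists_eq_add_of_le' hp.out.two_le
    rw [show D^[p] f = D^[n + 2] f from congr_arg (fun m => D^[m] f) hn,
      Function.iterate_succ_apply, Function.iterate_succ_apply, h1, h2]
    exact Function.iterate_fixed (map_zero D) n
  have hp0 : ∀ (D : Derivation (ZMod p) (Coord p) (Coord p)) (f : Coord p), D f = 0 →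
      D^[p] f = 0 := fun D f h => hp1 D f 0 h (map_zero D)
  refine ⟨?_, ?_, ?_, ?_, ?_, ?_, adjoin_eq_top p⟩
  · rw [← sub_eq_zero]
    refine ext_der _ ⁅derH p, derX p⁆ (2 • derX p) (derivation_ext p (fun i => ?_) fun i => ?_)
      fun f => ?_
    · simp [Derivation.commutator_apply]
    · simp [Derivation.commutator_apply, two_mul]
    · simp [Derivation.commutator_apply, translate_X, translate_H, two_mul, sub_sub]
  · rw [← sub_eq_zero]
    refine ext_der _ ⁅derH p, derY p⁆ (-(2 • derY p)) (derivation_ext p (fun i => ?_) fun i => ?_)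
      fun f => ?_
    · simp [Derivation.commutator_apply, two_mul]; abel
    · simp [Derivation.commutator_apply]
    · simp [Derivation.commutator_apply, translate_Y, translate_H, two_mul]; abel
  · rw [← sub_eq_zero]
    refine ext_der _ ⁅derX p, derY p⁆ (derH p) (derivation_ext p (fun i => ?_) fun i => ?_)
      fun f => ?_
    · simp [Derivation.commutator_apply]
    · simp [Derivation.commutator_apply]
    · simp [Derivation.commutator_apply, translate_X, translate_Y, translate_H, sub_sub]
  · refine ext_der _ ((derX p).powChar p) 0 (derivation_ext p (fun i => ?_) fun i => ?_)
      fun f => ?_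
    · rw [Derivation.powChar_apply, hp0 _ _ (derX_gen_zero i)]; rfl
    · rw [Derivation.powChar_apply, hp1 _ _ _ (derX_gen_one i) (derX_gen_zero i)]; rfl
    · rw [hpow _ _ (translate_X p), Derivation.zero_apply, sub_zero]
  · refine ext_der _ ((derY p).powChar p) 0 (derivation_ext p (fun i => ?_) fun i => ?_)
      fun f => ?_
    · rw [Derivation.powChar_apply, hp1 _ _ _ (derY_gen_zero i) (derY_gen_one i)]; rfl
    · rw [Derivation.powChar_apply, hp0 _ _ (derY_gen_one i)]; rfl
    · rw [hpow _ _ (translate_Y p), Derivation.zero_apply, sub_zero]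
  · rw [← sub_eq_zero]
    refine ext_der _ ((derH p).powChar p) (derH p) (derivation_ext p (fun i => ?_) fun i => ?_)
      fun f => ?_
    · rw [Derivation.powChar_apply, derH_gen_zero]
      exact Function.iterate_fixed (derH_gen_zero i) p
    · rw [Derivation.powChar_apply, derH_gen_one]
      -- `H` acts by `-1` on these functions, and `(-1) ^ p = -1` also for `p = 2`, where `-1 = 1`
      have h2 : ∀ n : ℕ, (derH p)^[n] (gen p i 1) = (-1) ^ n * gen p i 1 := by
        intro n
        induction n with
        | zero => simp
        | succ n ih =>
          rw [Function.iterate_succ_apply', ih, Derivation.leibniz, derH_gen_one,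
            Derivation.leibniz_pow]
          simp [pow_succ]
      rw [h2]
      obtain h | h := hp.out.eq_two_or_odd'
      · have h3 : (2 : Coord p) = 0 := by
          have := natCast_eq_zero (p := p) (Coord p)
          rwa [show (p : Coord p) = ((2 : ℕ) : Coord p) from congr_arg _ h, Nat.cast_ofNat] at this
        rw [show (-1 : Coord p) ^ p = 1 from Even.neg_one_pow (h ▸ even_two)]
        linear_combination (gen p i 1) * h3
      · rw [h.neg_one_pow, neg_one_mul]
    · rw [map_sub, LinearMap.sub_apply, hpow _ _ (translate_H p), translate_H]

/-- The function `x₀₀ ^ k`, for `k ≡ m` modulo `p`, is invertible, of weight `m` and killed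
by `X`. -/
theorem span_X_H_ne_top (m : ℤ) :
    Submodule.span (Dist p) {X p, H p - (m : Dist p)} ≠ ⊤ := by
  intro htop
  obtain ⟨k, hk⟩ : ∃ k : ℕ, (k : ZMod p) = m := ⟨(m : ZMod p).val, by simp⟩
  have key : ∀ μ ∈ Submodule.span (Dist p) {X p, H p - (m : Dist p)},
      translate p μ (gen p 0 0 ^ k) = 0 := by
    intro μ hμ
    induction hμ using Submodule.span_induction with
    | zero => simp
    | add x y _ _ hx hy => rw [map_add, LinearMap.add_apply, hx, hy, add_zero]
    | smul a x _ hx => rw [smul_eq_mul, map_mul, Module.End.mul_apply, hx, map_zero]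
    | mem x hx =>
      obtain rfl | rfl := hx
      · rw [translate_X, Derivation.leibniz_pow, derX_gen_zero, smul_zero, smul_zero]
      · have hk' : (k : Coord p) = (m : Coord p) := by
          rw [← map_natCast (algebraMap (ZMod p) (Coord p)), hk, map_intCast]
        have hm : translate p (m : Dist p) (gen p 0 0 ^ k) = m * gen p 0 0 ^ k := by
          rw [map_intCast, ← zsmul_one, LinearMap.smul_apply, Module.End.one_apply, zsmul_eq_mul]
        rw [map_sub, LinearMap.sub_apply, translate_H, Derivation.leibniz_pow, derH_gen_zero, hm,
          nsmul_eq_mul, smul_eq_mul, hk']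
        cases k with
        | zero => rw [← hk', Nat.cast_zero, zero_mul, zero_mul, sub_zero]
        | succ k => rw [Nat.add_sub_cancel, ← pow_succ, sub_self]
  have h1 := key 1 (htop ▸ Submodule.mem_top)
  rw [map_one, Module.End.one_apply] at h1
  have hu : IsUnit (gen p 0 0) := IsUnit.of_mul_eq_one _ (gen_zero_zero_mul_pow p)
  exact (hu.pow k).ne_zero h1

end Coordinates

section Decomposition

variable (p : ℕ) [hp : Fact p.Prime]

/-! ### The weight idempotents `μ_n` -/

/-- The polynomial `∑ (-1) ^ i binom(T, i)`, for `i < p`, over `𝔽_p`. -/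
def muPoly : Polynomial (ZMod p) :=
  ∑ i ∈ Finset.range p,
    (-1) ^ i * (Polynomial.C ((i.factorial : ZMod p)⁻¹) * descPochhammer (ZMod p) i)

theorem eval_muPoly {k : ℕ} (hk : k < p) :
    (muPoly p).eval (k : ZMod p) = if k = 0 then 1 else 0 := by
  have h1 : (muPoly p).eval (k : ZMod p) =
      ((∑ i ∈ Finset.range p, (-1) ^ i * (k.choose i : ℤ) : ℤ) : ZMod p) := by
    rw [muPoly, Polynomial.eval_finsetSum, Int.cast_sum]
    refine Finset.sum_congr rfl fun i hi => ?_
    have hi0 : (i.factorial : ZMod p) ≠ 0 := by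
      rw [Ne, ZMod.natCast_eq_zero_iff, hp.out.dvd_factorial]
      exact not_le.2 (Finset.mem_range.1 hi)
    rw [Polynomial.eval_mul, Polynomial.eval_mul, Polynomial.eval_C,
      descPochhammer_eval_eq_descFactorial, Nat.descFactorial_eq_factorial_mul_choose, Nat.cast_mul,
      inv_mul_cancel_left₀ hi0]
    simp
  have h2 : ∑ i ∈ Finset.range p, (-1) ^ i * (k.choose i : ℤ) =
      ∑ i ∈ Finset.range (k + 1), (-1) ^ i * (k.choose i : ℤ) := by
    refine (Finset.sum_subset (Finset.range_subset_range.2 hk) fun i _ hi => ?_).symm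
    rw [Finset.mem_range, not_lt] at hi
    rw [Nat.choose_eq_zero_of_lt (by omega), Nat.cast_zero, mul_zero]
  rw [h1, h2, Int.alternating_sum_range_choose]
  split_ifs <;> simp

theorem mu_eq_aeval (n : ℤ) : mu p n = Polynomial.aeval (H p - (n : Dist p)) (muPoly p) := by
  rw [mu, muPoly, map_sum]
  refine Finset.sum_congr rfl fun i _ => ?_
  rw [map_mul, map_mul, map_pow, map_neg, map_one, Polynomial.aeval_C, binomH, Algebra.smul_def,
    ← descPochhammer_map (algebraMap ℤ (ZMod p)), Polynomial.aeval_map_algebraMap]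

/-- The polynomial `∑ (-1) ^ i binom(T, i)` takes the value `1` at `0` and the value `0` at the
other elements of `𝔽_p`, and `H` is a root of `T ^ p - T`, the product of all `T - c`. -/
theorem isWeightIdempotent_mu (n : ℤ) : IsWeightIdempotent (H p) (mu p n) n := by
  set y := H p - (n : Dist p) with hy
  have hzero : ∀ c : ZMod p, (Polynomial.X * muPoly p).eval c = 0 := by
    intro c
    rw [Polynomial.eval_mul, Polynomial.eval_X, ← ZMod.natCast_zmod_val c,
      eval_muPoly p (ZMod.val_lt c)]
    split_ifs with h
    · rw [h, Nat.cast_zero, zero_mul]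
    · rw [mul_zero]
  have hdvd : Polynomial.X ^ p - Polynomial.X ∣
      (Polynomial.X * muPoly p).comp (Polynomial.X - Polynomial.C (n : ZMod p)) := by
    rw [← prod_X_sub_C_zmod]
    refine Finset.prod_dvd_of_coprime
      ((Polynomial.pairwise_coprime_X_sub_C Function.injective_id).set_pairwise _) fun c _ => ?_
    rw [Polynomial.dvd_iff_isRoot, Polynomial.IsRoot.def, Polynomial.eval_comp]
    exact hzero _
  have hyx : Polynomial.aeval (H p) (Polynomial.X - Polynomial.C (n : ZMod p)) = y := by
    rw [map_sub, Polynomial.aeval_X, Polynomial.aeval_C, map_intCast]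
  have hmul : y * mu p n = 0 := by
    obtain ⟨r, hr⟩ := hdvd
    have h := congr_arg (Polynomial.aeval (H p)) hr
    rwa [Polynomial.aeval_comp, hyx, map_mul, Polynomial.aeval_X, ← mu_eq_aeval, map_mul, map_sub,
      map_pow, Polynomial.aeval_X, (isRestrictedSl2 p).H_pow, sub_self, zero_mul] at h
  have hmul' : mu p n * y = 0 := by
    have h := congr_arg (Polynomial.aeval y) (mul_comm Polynomial.X (muPoly p))
    rwa [map_mul, map_mul, Polynomial.aeval_X, ← mu_eq_aeval, hmul, eq_comm] at h
  refine ⟨?_, ?_, ?_⟩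
  · rwa [hy, sub_mul, sub_eq_zero] at hmul
  · rwa [hy, mul_sub, sub_eq_zero, ← (Int.cast_commute n (mu p n)).eq] at hmul'
  · have hroot : Polynomial.X ∣ muPoly p - 1 := by
      have h := eval_muPoly p hp.out.pos
      rw [Nat.cast_zero, if_pos rfl] at h
      rw [Polynomial.X_dvd_iff, Polynomial.coeff_zero_eq_eval_zero, Polynomial.eval_sub, h,
        Polynomial.eval_one, sub_self]
    obtain ⟨r, hr⟩ := hroot
    have h := congr_arg (Polynomial.aeval y) (hr.trans (mul_comm _ _))
    rw [map_sub, map_one, map_mul, Polynomial.aeval_X, ← mu_eq_aeval] at h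
    exact ⟨Polynomial.aeval y r, sub_eq_iff_eq_add'.1 h⟩

/-! ### Simple modules, their projective covers, and the decomposition -/

theorem exists_isSimpleOfHighestWeight (m : ℤ) : ∃ J : Submodule (Dist p) (Dist p),
    IsSimpleOfHighestWeight p m (Dist p ⧸ J) := by
  obtain ⟨J, hJ, hle⟩ := Ideal.exists_le_maximal _ (span_X_H_ne_top p m)
  refine ⟨J, isSimpleModule_iff_isCoatom.2 hJ.out, Submodule.Quotient.mk 1, ?_, ?_, ?_⟩
  · rw [Ne, Submodule.Quotient.mk_eq_zero]
    exact fun h => hJ.ne_top ((Ideal.eq_top_iff_one _).2 h)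
  · rw [← Submodule.Quotient.mk_smul, smul_eq_mul, mul_one, Submodule.Quotient.mk_eq_zero]
    exact hle (Submodule.subset_span (Or.inl rfl))
  · rw [← sub_eq_zero, ← Int.cast_smul_eq_zsmul (Dist p), ← sub_smul, ← Submodule.Quotient.mk_smul,
      smul_eq_mul, mul_one, Submodule.Quotient.mk_eq_zero]
    exact hle (Submodule.subset_span (Or.inr rfl))

theorem exists_projectiveCover (m : ℤ) : ∃ (L Q : Type) (_ : AddCommGroup L)
    (_ : Module (Dist p) L) (_ : AddCommGroup Q) (_ : Module (Dist p) Q) (f : Q →ₗ[Dist p] L),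
      IsSimpleOfHighestWeight p m L ∧ IsProjectiveCover f := by
  obtain ⟨J, hJ⟩ := exists_isSimpleOfHighestWeight p m
  obtain ⟨Q, _, _, f, hf⟩ := exists_isProjectiveCover (A := Dist p) (Dist p ⧸ J)
  exact ⟨Dist p ⧸ J, Q, _, _, _, _, f, hJ, hf⟩

variable {p}

theorem IsSimpleOfHighestWeight.exists_isHighestWeightVector {m : ℤ} {L : Type*} [AddCommGroup L]
    [Module (Dist p) L] (h : IsSimpleOfHighestWeight p m L) {l : ℤ} (hl : (p : ℤ) ∣ m - l) :
    ∃ v : L, IsHighestWeightVector (X p) (H p) l v := by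
  obtain ⟨_, v, hv0, hX, hH⟩ := h
  exact ⟨v, hv0, hX, hH.trans (zsmul_eq_zsmul_of_dvd (Dist p) hl v)⟩

variable (p) in
theorem isSimpleModule_steinberg : IsSimpleModule (Dist p) (Steinberg p) :=
  (isRestrictedSl2 p).isSimpleModule_of_weight_sub_one (span_X_H_ne_top p _)

variable (p) in
theorem projective_steinberg : Module.Projective (Dist p) (Steinberg p) :=
  (isRestrictedSl2 p).projective_of_weight_sub_one (isWeightIdempotent_mu p _)
    (span_X_H_ne_top p _)

variable (p) in
theorem isHighestWeightVector_steinberg : ∃ v : Steinberg p,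
    IsHighestWeightVector (X p) (H p) ((p : ℤ) - 1) v :=
  ⟨_, isHighestWeightVector_mk (span_X_H_ne_top p _)⟩

/-- The Steinberg module is simple and projective, hence its own projective cover. -/
theorem nonempty_equiv_steinberg {m : ℤ} (hm : (p : ℤ) ∣ m - (p - 1)) {L Q : Type*}
    [AddCommGroup L] [Module (Dist p) L] [AddCommGroup Q] [Module (Dist p) Q] {f : Q →ₗ[Dist p] L}
    (hL : IsSimpleOfHighestWeight p m L) (hf : IsProjectiveCover f) :
    Nonempty (Q ≃ₗ[Dist p] Steinberg p) := by
  have := isSimpleModule_steinberg p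
  have := projective_steinberg p
  have := hL.1
  obtain ⟨v, hv⟩ := hL.exists_isHighestWeightVector hm
  obtain ⟨w, hw⟩ := isHighestWeightVector_steinberg p
  obtain ⟨e⟩ := (isRestrictedSl2 p).nonempty_equiv_of_isHighestWeightVector
    (by rw [sub_self]; exact dvd_zero _) hv hw
  exact (hf.equiv_comp e).nonempty_equiv (IsProjectiveCover.id _)

/-- For odd `p` the module `Dist(G₁) μ_n` is the sum of the projective covers of the simple modules
with weight `n`. For `0 ≤ i ≤ l < p`, the integer `l - 2 i` is congruent to `n` modulo `p` only if it
equals `n` or `n - p`. With `m = n + i` in the first case and `m = n + i - p` in the second, `l` is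
congruent to `2 m - n`. -/
theorem nonempty_distMu_equiv (hodd : Odd p) {L : ℤ → Type u} {Q : ℤ → Type v}
    [∀ m, AddCommGroup (L m)] [∀ m, Module (Dist p) (L m)] [∀ m, AddCommGroup (Q m)]
    [∀ m, Module (Dist p) (Q m)] (f : ∀ m, Q m →ₗ[Dist p] L m)
    (hL : ∀ m, IsSimpleOfHighestWeight p m (L m)) (hf : ∀ m, IsProjectiveCover (f m))
    {n a b : ℤ} (hn : 0 ≤ n) (hnp : n < p) (ha : n - 2 ≤ 2 * a) (ha' : 2 * a ≤ n - 1)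
    (hb : p + n - 2 ≤ 2 * b) (hb' : 2 * b ≤ p + n - 1) :
    Nonempty (DistMu p n ≃ₗ[Dist p]
      DirectSum ↥(Set.Icc 0 a ∪ Set.Icc n b : Set ℤ) (fun m => Q (2 * m - n))) := by
  obtain ⟨q, hq⟩ := hodd
  set S : Set ℤ := Set.Icc 0 a ∪ Set.Icc n b with hS
  let l : S → ℕ := fun s => (if (s : ℤ) < n then 2 * s - n + p else 2 * s - n).toNat
  let i : S → ℕ := fun s => (if (s : ℤ) < n then s - n + p else s - n : ℤ).toNat
  have hmem : ∀ s : S, (0 ≤ (s : ℤ) ∧ (s : ℤ) ≤ a) ∨ (n ≤ (s : ℤ) ∧ (s : ℤ) ≤ b) := fun s => s.2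
  have hl : ∀ s : S, ((s : ℤ) < n ∧ (l s : ℤ) = 2 * s - n + p ∧ (i s : ℤ) = s - n + p) ∨
      (n ≤ (s : ℤ) ∧ (l s : ℤ) = 2 * s - n ∧ (i s : ℤ) = s - n) := by
    intro s
    have := hmem s
    by_cases h : (s : ℤ) < n
    · simp only [l, i, if_pos h]
      omega
    · simp only [l, i, if_neg h]
      omega
  have hw : ∀ s : S, ∃ v : L (2 * s - n), IsHighestWeightVector (X p) (H p) (l s) v := fun s =>
    (hL _).exists_isHighestWeightVector <| by
      obtain h | h := hl s
      · exact ⟨-1, by omega⟩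
      · exact ⟨0, by omega⟩
  choose v hv using hw
  have := fun m => (hL m).1
  obtain ⟨g, hg⟩ := (isRestrictedSl2 p).exists_isProjectiveCover_span (isWeightIdempotent_mu p n)
    (ι := S) (L := fun s => L (2 * s - n)) (l := l) (i := i) (v := v)
    (fun s => by have := hl s; have := hmem s; omega)
    (fun s => by have := hl s; have := hmem s; omega)
    (fun s t hst => Subtype.ext <| by
      have := hl s
      have := hl t
      have := hmem s
      have := hmem t
      omega)
    hv
    (fun s => by
      obtain h | h := hl s
      · exact ⟨-1, by omega⟩
      · exact ⟨0, by omega⟩)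
    (fun l' i' hl' hi' ⟨c, hc⟩ => by
      have hp0 : (0 : ℤ) < p := Int.natCast_pos.2 hp.out.pos
      have hc1 : c < 1 := by
        by_contra! h
        nlinarith
      have hc2 : -2 < c := by
        by_contra! h
        nlinarith
      obtain rfl | rfl : c = 0 ∨ c = -1 := by omega
      · have hs : (i' + n : ℤ) ∈ S := Or.inr ⟨by omega, by omega⟩
        refine ⟨⟨_, hs⟩, ?_⟩
        have := hl ⟨_, hs⟩
        simp only at this
        omega
      · have hs : (i' + n - p : ℤ) ∈ S := Or.inl ⟨by omega, by omega⟩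
        refine ⟨⟨_, hs⟩, ?_⟩
        have := hl ⟨_, hs⟩
        simp only at this
        omega)
  exact hg.nonempty_equiv (IsProjectiveCover.directSum (fun s : S => f (2 * s - n)) fun s => hf _)

/-- In characteristic two the simple modules of highest weight `0` and `1` have the weights `0`
and `1`, `-1`, so that the weight `1` has multiplicity two in the Steinberg module. -/
theorem nonempty_distMu_equiv_of_two [Fact (Nat.Prime 2)] {L : Type u} {Q : Type v}
    [AddCommGroup L] [Module (Dist 2) L] [AddCommGroup Q] [Module (Dist 2) Q] {f : Q →ₗ[Dist 2] L}
    (hL : IsSimpleOfHighestWeight 2 0 L) (hf : IsProjectiveCover f) :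
    Nonempty (DistMu 2 0 ≃ₗ[Dist 2] Q) ∧
      Nonempty (DistMu 2 1 ≃ₗ[Dist 2] Steinberg 2 × Steinberg 2) := by
  constructor
  · have := hL.1
    obtain ⟨v, hv⟩ := hL.exists_isHighestWeightVector (l := 0) (by simp)
    obtain ⟨g, hg⟩ := (isRestrictedSl2 2).exists_isProjectiveCover_span
      (isWeightIdempotent_mu 2 0) (ι := Unit) (L := fun _ => L) (l := fun _ => 0) (i := fun _ => 0)
      (v := fun _ => v) (by simp) (by simp) (fun _ _ _ => rfl) (fun _ => hv) (by simp)
      (fun l' i' hl' hi' hdvd => ⟨(), by omega⟩)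
    exact (hg.equiv_comp (DirectSum.lid (Dist 2) L Unit)).nonempty_equiv hf
  · have := isSimpleModule_steinberg 2
    have := projective_steinberg 2
    obtain ⟨v, hv⟩ := isHighestWeightVector_steinberg 2
    obtain ⟨g, hg⟩ := (isRestrictedSl2 2).exists_isProjectiveCover_span
      (isWeightIdempotent_mu 2 1) (ι := Fin 2) (L := fun _ => Steinberg 2) (l := fun _ => 1)
      (i := fun s => s) (v := fun _ => v) (by simp) (fun s => by omega) Fin.val_injective
      (fun _ => hv) (fun s => by omega)
      (fun l' i' hl' hi' hdvd => ⟨⟨i', by omega⟩, by omega, rfl⟩)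
    exact (hg.equiv_comp (DirectSum.linearEquivFunOnFintype _ _ _ ≪≫ₗ
      LinearEquiv.finTwoArrow (Dist 2) (Steinberg 2))).nonempty_equiv (IsProjectiveCover.id _)

end Decomposition

end FrobeniusKernel

end

open FrobeniusKernel in
theorem proposition5 (p : ℕ) [Fact p.Prime] :
    (∀ m : ℤ, ∃ (L Q : Type) (_ : AddCommGroup L) (_ : Module (Dist p) L)
      (_ : AddCommGroup Q) (_ : Module (Dist p) Q) (f : Q →ₗ[Dist p] L),
      IsSimpleOfHighestWeight p m L ∧ IsProjectiveCover f) ∧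
    ∀ (L : ℤ → Type u) (Q : ℤ → Type v) [∀ m, AddCommGroup (L m)] [∀ m, Module (Dist p) (L m)]
      [∀ m, AddCommGroup (Q m)] [∀ m, Module (Dist p) (Q m)] (f : ∀ m, Q m →ₗ[Dist p] L m),
      (∀ m, IsSimpleOfHighestWeight p m (L m)) → (∀ m, IsProjectiveCover (f m)) →
      (p = 2 →
        Nonempty (DistMu p 0 ≃ₗ[Dist p] Q 0) ∧
        Nonempty (DistMu p 1 ≃ₗ[Dist p] Steinberg p × Steinberg p)) ∧
      (Odd p → ∀ n : ℤ, 0 ≤ n → n < p → Even n →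
        Nonempty (DistMu p n ≃ₗ[Dist p]
          DirectSum ↥(Set.Icc 0 ((n - 2) / 2) ∪ Set.Icc n ((p + n - 1) / 2) : Set ℤ)
            (fun m => Q (2 * m - n))) ∧
        (p + n - 1) / 2 ∈ (Set.Icc 0 ((n - 2) / 2) ∪ Set.Icc n ((p + n - 1) / 2) : Set ℤ) ∧
        Nonempty (Q (2 * ((p + n - 1) / 2) - n) ≃ₗ[Dist p] Steinberg p)) ∧
      (Odd p → ∀ n : ℤ, 0 ≤ n → n < p → Odd n →
        Nonempty (DistMu p n ≃ₗ[Dist p]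
          DirectSum ↥(Set.Icc 0 ((n - 1) / 2) ∪ Set.Icc n ((p + n - 2) / 2) : Set ℤ)
            (fun m => Q (2 * m - n))) ∧
        (n - 1) / 2 ∈ (Set.Icc 0 ((n - 1) / 2) ∪ Set.Icc n ((p + n - 2) / 2) : Set ℤ) ∧
        Nonempty (Q (2 * ((n - 1) / 2) - n) ≃ₗ[Dist p] Steinberg p)) := by
  refine ⟨exists_projectiveCover p, fun L Q _ _ _ _ f hL hf => ⟨?_, ?_, ?_⟩⟩
  · rintro rfl
    exact nonempty_distMu_equiv_of_two (hL 0) (hf 0)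
  · rintro hp n hn hnp ⟨k, rfl⟩
    have hp' := hp
    obtain ⟨q, hq⟩ := hp'
    refine ⟨nonempty_distMu_equiv hp f hL hf hn hnp ?_ ?_ ?_ ?_, Or.inr ⟨?_, le_rfl⟩,
      nonempty_equiv_steinberg ⟨0, ?_⟩ (hL _) (hf _)⟩
    all_goals omega
  · rintro hp n hn hnp ⟨k, rfl⟩
    have hp' := hp
    obtain ⟨q, hq⟩ := hp'
    refine ⟨nonempty_distMu_equiv hp f hL hf hn hnp ?_ ?_ ?_ ?_, Or.inl ⟨?_, le_rfl⟩,
      nonempty_equiv_steinberg ⟨-1, ?_⟩ (hL _) (hf _)⟩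
    all_goals omega
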